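/- Let $d\ge 1$, $\mathcal X=[0,1]^d$ with the supremum norm and Lebesgue measure $\lambda_d$, let $\varphi:\mathcal X\to\mathbb R$ be continuous and $\varphi^*=\sup_{\mathcal X}\varphi$. Let $K$ be a Markov kernel on $\mathcal X$ which admits a density $K(\mathbf y|\mathbf x)$ that is continuous on $\mathcal X^2$ and satisfies $K(\mathbf y|\mathbf x)\ge \underline K$ for all $\mathbf x,\mathbf y$ and some constant $\underline K>0$. Let $F_K(\mathbf x,\cdot)$ be the Rosenblatt transformation of $K(\mathbf x,\mathrm d\mathbf y)$, whose $i$-th component is the conditional distribution function of $y_i$ given $y_1,\dots,y_{i-1}$, and let $F_K^{-1}(\mathbf x,\cdot)$ be its inverse, obtained by successively inverting these conditional distribution functions; assume that the $i$-th component of $F_K(\mathbf x,\mathbf y)$ is strictly increasing in $y_i\in[0,1]$, for all $\mathbf x$ and $i$. For $\mathbf x\in\mathcal X$ let $\mathcal X_{\varphi(\mathbf x)}=\{\mathbf x'\in\mathcal X:\varphi(\mathbf x')=\varphi(\mathbf x)\}$, and assume that for all $\mathbf x$ with $\varphi(\mathbf x)<\varphi^*$ the limit $M(\mathcal X_{\varphi(\mathbf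 x)})=\lim_{\epsilon\downarrow0}\epsilon^{-1}\lambda_d(\{\mathbf z\in\mathcal X:\exists\,\mathbf x'\in\mathcal X_{\varphi(\mathbf x)},\ \|\mathbf z-\mathbf x'\|_\infty\le\epsilon\})$ exists and is finite, and that $\sup_{\mathbf x:\varphi(\mathbf x)<\varphi^*}M(\mathcal X_{\varphi(\mathbf x)})<\infty$. Let $b\ge2$ and $t\ge0$ be integers. A sequence $(\mathbf u^n)_{n\ge0}$ in $[0,1)^d$ is a $(t,d)$-sequence in base $b$ if, for all integers $a\ge0$ and $m\ge t$, every box $\prod_{j=1}^d[a_jb^{-e_j},(a_j+1)b^{-e_j})$ with integers $e_j\ge 0$, $0\le a_j<b^{e_j}$ and volume $b^{t-m}$ contains exactly $b^t$ of the points $\mathbf u^n$, $ab^m\le n<(a+1)b^m$, counted with multiplicity. For $R\in\mathbb N=\{0,1,2,\dots\}$, a $(t,d)_R$-sequence $(\mathbf u^n_R)_{n\ge 0}$ in base $b$ is given by $u^n_{R,i}=\sum_{k=1}^Ra^n_{ki}b^{-k}+b^{-R}z^n_i$, $1\le i\le d$, where the $z_i^n$ are i.i.d. uniform random variables in $[0,1)$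 and the deterministic digits $a^n_{ki}\in\{0,\dots,b-1\}$ are such that the points $\big(\sum_{k\ge1}a^n_{ki}b^{-k}\big)_{1\le i\le d}$, $n\ge0$, form a $(t,d)$-sequence in base $b$; a $(t,d)_\infty$-sequence is a (deterministic) $(t,d)$-sequence. Consider the following algorithm, with input a starting point $\mathbf x^0\in\mathcal X$, a number $l_1>0$ and a $(t,d)_R$-sequence $(\mathbf u_R^n)_{n\ge 0}$ in base $b$. At iteration $n\ge1$ compute $\mathbf y^n=F_K^{-1}(\mathbf x^{n-1},\mathbf u_R^n)$; if $\varphi(\mathbf y^n)\ge\varphi(\mathbf x^{n-1})$, set $\mathbf x^n=\mathbf y^n$; if $\varphi(\mathbf y^n)<\varphi(\mathbf x^{n-1})-l_n^{-1}$, set $\mathbf x^n=\mathbf x^{n-1}$; otherwise set $\mathbf x^n=\mathbf x^{n-1}$ or $\mathbf x^n=\mathbf y^n$ according to an arbitrary rule; then select $l_{n+1}\in[l_n,\infty)$. For finite $R$ the rule must be non-anticipating: there is a filtration $(\mathcal F_n)_{n\ge 0}$ such that $\mathbf u_R^n$ and $\mathbf x^n$ are $\mathcal F_n$-measurable and $\mathbf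 u_R^{n+1}$ is independent of $\mathcal F_n$, for all $n\ge0$ (so the rule may depend on the history and on additional randomness, and the $l_n$ may be adaptive). If $\sum_{n=1}^\infty l_n^{-1}<\infty$ (almost surely, if the $l_n$ are random), then, for every $R\in\mathbb N$, $\varphi(\mathbf x^n)\to\varphi^*$ almost surely as $n\to\infty$. If $d=1$ and $R=\infty$, then $\varphi(x^n)\to\varphi^*$ for every trajectory of the algorithm with $\sum_{n=1}^\infty l_n^{-1}<\infty$. -/

import Mathlib

open MeasureTheory ProbabilityTheory Filter Topology

namespace QMCSA

/-- The state space `[0,1]^d`, with Lebesgue measure `volume` and the supremum distance. -/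
abbrev Cube (d : ℕ) : Type := Fin d → unitInterval

/-! ### Nets and sequences -/

/-- The `b`-ary box `∏ⱼ [aⱼ b^{-eⱼ}, (aⱼ+1) b^{-eⱼ})`. -/
def bBox {s : ℕ} (b : ℕ) (a e : Fin s → ℕ) : Set (Fin s → ℝ) :=
  {u | ∀ j, u j ∈ Set.Ico ((a j : ℝ) / (b : ℝ) ^ e j) (((a j : ℝ) + 1) / (b : ℝ) ^ e j)}

open Classical in
/-- The points `P 0, …, P (b^m - 1)` of `[0,1)^s` form a `(t,m,s)`-net in base `b`: every `b`-ary
box of volume `b^{t-m}` contains exactly `b^t` of them (counted with multiplicity). -/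
def IsNet {s : ℕ} (b t m : ℕ) (P : ℕ → Fin s → ℝ) : Prop :=
  2 ≤ b ∧ 1 ≤ s ∧ t ≤ m ∧
  (∀ n < b ^ m, ∀ j, P n j ∈ Set.Ico (0 : ℝ) 1) ∧
  ∀ a e : Fin s → ℕ, (∀ j, a j < b ^ e j) → (∑ j, e j) + t = m →
    ((Finset.range (b ^ m)).filter (fun n => P n ∈ bBox b a e)).card = b ^ t

/-- `u` is a `(t,s)`-sequence in base `b`. -/
def IsTSSequence {s : ℕ} (b t : ℕ) (u : ℕ → Fin s → ℝ) : Prop :=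
  ∀ a m : ℕ, t ≤ m → IsNet b t m (fun n => u (a * b ^ m + n))

/-- `u` is, for finite `R`, a `(t,s)_R`-sequence in base `b` on the probability space `(Ω, P)`:
`u^n_i = ∑_{k=1}^R a^n_{ki} b^{-k} + b^{-R} z^n_i` with i.i.d. variables `z^n_i`, uniform in
`[0,1)`, and base `b` digits `a^n_{ki}` for which `u^n_{∞,i} = ∑_{k≥1} a^n_{ki} b^{-k}` is a
`(t,s)`-sequence. The digit `a^n_{ki}` is `a n (k-1) i` below. -/
def IsTSRSequence {Ω : Type*} [MeasurableSpace Ω] (P : Measure Ω) {s : ℕ} (b t R : ℕ)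
    (u : ℕ → Ω → Fin s → ℝ) : Prop :=
  ∃ (a : ℕ → ℕ → Fin s → ℕ) (z : ℕ → Fin s → Ω → ℝ),
    (∀ n k i, a n k i < b) ∧
    IsTSSequence b t (fun n i => ∑' k : ℕ, (a n k i : ℝ) / (b : ℝ) ^ (k + 1)) ∧
    (∀ n i, Measurable (z n i)) ∧
    (∀ n i ω, z n i ω ∈ Set.Ico (0 : ℝ) 1) ∧
    (∀ n i, P.map (z n i) = volume.restrict (Set.Ico (0 : ℝ) 1)) ∧
    iIndepFun (fun p : ℕ × Fin s => z p.1 p.2) P ∧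
    ∀ n ω i, u n ω i =
      (∑ k ∈ Finset.range R, (a n k i : ℝ) / (b : ℝ) ^ (k + 1)) + z n i ω / (b : ℝ) ^ R

/-! ### Rosenblatt transformations and the assumptions on the kernel -/

/-- The point with the coordinates of `y` before `i`, and those of `w` from `i` on. -/
def splice {d : ℕ} (i : Fin d) (y w : Cube d) : Cube d := fun j => if j < i then y j else w j

/-- The Rosenblatt transformation of the distribution with density `f` on `[0,1]^d`: its `i`-th
component is the conditional distribution function of coordinate `i` given the previous ones,
`∫_0^{y_i} f(y_{1:i-1}, w_{i:d}) dw_{i:d} / ∫_0^1 f(y_{1:i-1}, w_{i:d}) dw_{i:d}`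
(the integrand does not depend on `w_1, …, w_{i-1}`, which range over `[0,1]`). -/
noncomputable def rosenblatt {d : ℕ} (f : Cube d → ℝ) (y : Cube d) (i : Fin d) : ℝ :=
  (∫ w in {w : Cube d | w i ≤ y i}, f (splice i y w)) / ∫ w, f (splice i y w)

/-- The inverse Rosenblatt transformation: its `i`-th component is the inverse of the conditional
distribution function of coordinate `i` given the previous ones,
`y_i = inf {s : F_i(s | y_{1:i-1}) ≥ u_i}`, computed successively for `i = 1, …, d`. -/
noncomputable def invRosenblatt {d : ℕ} (f : Cube d → ℝ) (u : Fin d → ℝ) (i : Fin d) :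
    unitInterval :=
  sInf {s : unitInterval |
    u i ≤ rosenblatt f (fun j => if _h : j < i then invRosenblatt f u j else s) i}
termination_by i.val

/-- `k x` is a density of `K x` with respect to Lebesgue measure on `[0,1]^d`. -/
def IsDensity {d : ℕ} (K : Kernel (Cube d) (Cube d)) (k : Cube d → Cube d → ℝ) : Prop :=
  ∀ x, K x = volume.withDensity (fun y => ENNReal.ofReal (k x y))

/-- For fixed `x`, the `i`-th component of `F_K(x, y)` is strictly increasing in `y_i ∈ [0,1]`. -/
def AssumptionA1 {d : ℕ} (k : Cube d → Cube d → ℝ) : Prop :=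
  ∀ (x y : Cube d) (i : Fin d),
    StrictMono (fun s : unitInterval => rosenblatt (k x) (Function.update y i s) i)

/-- `k` is a continuous density of `K`, bounded below by a positive constant. -/
def AssumptionA2 {d : ℕ} (K : Kernel (Cube d) (Cube d)) (k : Cube d → Cube d → ℝ) : Prop :=
  IsDensity K k ∧ Continuous (Function.uncurry k) ∧ ∃ c : ℝ, 0 < c ∧ ∀ x y, c ≤ k x y

/-! ### Level sets and Minkowski content -/

/-- `(A)_ε`, the points of `[0,1]^d` at distance at most `ε` from a point of `A`. -/
def thickened {d : ℕ} (A : Set (Cube d)) (ε : ℝ) : Set (Cube d) := {x | ∃ x' ∈ A, dist x x' ≤ ε}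

/-- `A` has the finite `(d-1)`-dimensional Minkowski content `M`. -/
def HasMinkowskiContent {d : ℕ} (A : Set (Cube d)) (M : ℝ) : Prop :=
  Tendsto (fun ε : ℝ => ε⁻¹ * (volume (thickened A ε)).toReal) (𝓝[>] 0) (𝓝 M)

/-- The level set of `φ` through `x`. -/
def levelSet {d : ℕ} (φ : Cube d → ℝ) (x : Cube d) : Set (Cube d) := {x' | φ x' = φ x}

/-- The level sets of `φ` below `φ* = sup φ` have Minkowski contents, bounded by one constant. -/
def LevelSetsBounded {d : ℕ} (φ : Cube d → ℝ) : Prop :=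
  ∃ C : ℝ, ∀ x, φ x < (⨆ x', φ x') → ∃ M ≤ C, HasMinkowskiContent (levelSet φ x) M

/-! ### The algorithm -/

/-- `x` is a trajectory of the algorithm for the kernel density `k`, the objective `φ`, the input
points `u` and the inverse thresholds `l` (`l n` and `u n` are used at iteration `n ≥ 1`). -/
structure IsRun {d : ℕ} (k : Cube d → Cube d → ℝ) (φ : Cube d → ℝ) (u : ℕ → Fin d → ℝ)
    (l : ℕ → ℝ) (x : ℕ → Cube d) : Prop where
  /-- The first inverse threshold is positive. -/
  l_pos : 0 < l 1
  /-- Inverse thresholds do not decrease. -/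
  l_mono : ∀ n, 1 ≤ n → l n ≤ l (n + 1)
  /-- Candidates that are at least as good are accepted. -/
  up : ∀ n, φ (x n) ≤ φ (invRosenblatt (k (x n)) (u (n + 1))) →
    x (n + 1) = invRosenblatt (k (x n)) (u (n + 1))
  /-- Candidates that are worse by more than the threshold are rejected. -/
  reject : ∀ n, φ (invRosenblatt (k (x n)) (u (n + 1))) < φ (x n) - (l (n + 1))⁻¹ →
    x (n + 1) = x n
  /-- In the remaining case the candidate is accepted or rejected, by any rule. -/
  step : ∀ n, x (n + 1) = x n ∨ x (n + 1) = invRosenblatt (k (x n)) (u (n + 1))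

end QMCSA

/-!
Up to the convergent series of the inverse thresholds the objective increases along a trajectory,
so `φ (x n)` converges to some value `v` of `φ` (`IsRun.exists_tendsto`). It has to be shown that
`v < φ* = sup φ` is impossible (almost surely, in the random case). While `φ (x n)` remains in
a narrow interval around `v`, a candidate whose value lies above the interval cannot occur, because
it would be accepted, and one whose value lies below it is not accepted. So the trajectory moves
only when a candidate falls into the thin set `A` where `φ` is close to `v`, and it must miss a
fixed nonempty open set `H` of better points.

*Partially random points.* The content assumption makes the level sets null sets
(`HasMinkowskiContent.volume_eq_zero`), so that `A` can be taken as small as desired in comparison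
with `H` (`exists_small_slab`). For a uniform `U` the point `F_K⁻¹(x, U)` has distribution `K(x, ·)`
(`unifMeasure_preimage_inverse`, from a computation by induction on the dimension), whose density is
bounded above and below. The point `u n` is uniform in a `b`-adic cube of side `b^{-R}`, and the
cubes of a long aligned block of indices cover `[0,1)^d` (`IsTSRSequence.exists_bounds`). Hence,
given the past, a candidate of the block falls into `A` with a small probability, and if none does,
then the trajectory stands still and hits `H` with a probability that is bounded below. The
probability that the trajectory remains in `A` therefore decreases geometrically from block to block
(`measure_stay_eq_zero`), and countably many intervals with rational endpoints suffice.

*Deterministic points, `d = 1`.* Now the content assumption makes the level set of `v` finite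
(`HasMinkowskiContent.finite`). A move from near `z` to near `z'`, both in the level set, needs an
input near `F_K(z, z')`, so the inputs of all moves lie in finitely many short intervals.
A `(t,1)`-sequence visits these at most a number of times that does not depend on the length of the
block, if the intervals are short enough (`IsTSSequence.card_filter_abs_sub_lt`). On the other hand
each of its aligned subblocks, of a fixed length, contains a move, as otherwise the trajectory would
stand still and an input would lead to `H` (`IsTSSequence.exists_mem_Ioo`). For long blocks this is
a contradiction (`tendsto_of_isTSSequence`).
-/

namespace QMCSA

/-! ### Continuity and inversion of the Rosenblatt transformation -/

lemma volume_singleton_unitInterval (s : unitInterval) : volume ({s} : Set unitInterval) = 0 := by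
  simp

/-- Hyperplanes orthogonal to a coordinate axis are null sets of the cube. -/
lemma volume_coord_eq {d : ℕ} (i : Fin d) (s : unitInterval) :
    volume {w : Cube d | w i = s} = 0 := by
  have hmp := measurePreserving_eval (fun _ : Fin d => (volume : Measure unitInterval)) i
  have h := hmp.measure_preimage (MeasurableSet.singleton s).nullMeasurableSet
  rw [volume_singleton_unitInterval] at h
  exact h

/-- The integral of a continuous function over a sublevel set `{c ≤ a x}` depends continuously on
the parameter `x`, provided that the level sets of `c` are null sets. -/
lemma continuous_setIntegral_le {X W : Type*} [TopologicalSpace X] [CompactSpace X]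
    [FirstCountableTopology X] [TopologicalSpace W] [CompactSpace W] [MeasureSpace W]
    [BorelSpace W] [IsFiniteMeasure (volume : Measure W)] {F : X → W → ℝ}
    (hF : Continuous (Function.uncurry F)) {a : X → unitInterval} (ha : Continuous a)
    {c : W → unitInterval} (hc : Continuous c) (h0 : ∀ s, volume {w | c w = s} = 0) :
    Continuous fun x => ∫ w in {w | c w ≤ a x}, F x w := by
  obtain ⟨B, hB⟩ := (isCompact_range hF).isBounded.exists_norm_le
  have hms : ∀ s, MeasurableSet {w | c w ≤ s} := fun s =>
    (isClosed_le hc continuous_const).measurableSet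
  have heq : (fun x => ∫ w in {w | c w ≤ a x}, F x w) =
      fun x => ∫ w, Set.indicator {w | c w ≤ a x} (F x) w := by
    funext x
    rw [integral_indicator (hms _)]
  rw [heq, continuous_iff_continuousAt]
  intro x₀
  refine continuousAt_of_dominated (bound := fun _ => B) ?_ ?_ (integrable_const B) ?_
  · exact Eventually.of_forall fun x =>
      (hF.comp (Continuous.prodMk_right x)).aestronglyMeasurable.indicator (hms _)
  · refine Eventually.of_forall fun x => Eventually.of_forall fun w => ?_
    exact (norm_indicator_le_norm_self _ _).trans (hB _ ⟨(x, w), rfl⟩)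
  · have hne : ∀ᵐ w : W, c w ≠ a x₀ := by
      rw [ae_iff]; simpa using h0 (a x₀)
    filter_upwards [hne] with w hw
    have hcont : ContinuousAt (fun x => F x w) x₀ :=
      (hF.comp (Continuous.prodMk_left w)).continuousAt
    rcases lt_or_gt_of_ne hw with h | h
    · refine hcont.congr ?_
      filter_upwards [ha.continuousAt.eventually (lt_mem_nhds h)] with x hx
      exact (Set.indicator_of_mem (s := {w | c w ≤ a x}) hx.le _).symm
    · refine (continuousAt_const (y := (0 : ℝ))).congr ?_
      filter_upwards [ha.continuousAt.eventually (gt_mem_nhds h)] with x hx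
      exact (Set.indicator_of_notMem (s := {w | c w ≤ a x}) (not_le.2 hx) _).symm

lemma continuous_splice {d : ℕ} (i : Fin d) :
    Continuous fun p : Cube d × Cube d => splice i p.1 p.2 := by
  refine continuous_pi fun j => ?_
  by_cases h : j < i <;> simp only [splice, h, if_true, if_false] <;> fun_prop

lemma integrable_of_continuous_cube {d : ℕ} {f : Cube d → ℝ} (hf : Continuous f) :
    Integrable f := by
  simpa using hf.continuousOn.integrableOn_compact (μ := volume) isCompact_univ

lemma integral_pos_of_continuous_cube {d : ℕ} {f : Cube d → ℝ} (hf : Continuous f)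
    (pos : ∀ y, 0 < f y) : 0 < ∫ y, f y := by
  rw [integral_pos_iff_support_of_nonneg (fun y => (pos y).le) (integrable_of_continuous_cube hf)]
  have : Function.support f = Set.univ := by
    ext y; simp [(pos y).ne']
  simp [this]

/-- The Rosenblatt transformation is continuous, jointly in the point and in the parameter of
a continuous family of positive densities. -/
lemma continuous_rosenblatt {X : Type*} [TopologicalSpace X] [CompactSpace X]
    [FirstCountableTopology X] {d : ℕ} {k : X → Cube d → ℝ}
    (hk : Continuous (Function.uncurry k)) (pos : ∀ x y, 0 < k x y) (i : Fin d) :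
    Continuous fun p : X × Cube d => rosenblatt (k p.1) p.2 i := by
  have hF : Continuous (Function.uncurry fun (p : X × Cube d) (w : Cube d) =>
      k p.1 (splice i p.2 w)) :=
    hk.comp ((continuous_fst.comp continuous_fst).prodMk
      ((continuous_splice i).comp ((continuous_snd.comp continuous_fst).prodMk continuous_snd)))
  have hnum := continuous_setIntegral_le hF
    ((continuous_apply i).comp (continuous_snd : Continuous (Prod.snd : X × Cube d → Cube d)))
    (continuous_apply i : Continuous fun w : Cube d => w i) (volume_coord_eq i)
  have hden := continuous_setIntegral_le hF (a := fun _ => 1) continuous_const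
    (continuous_apply i : Continuous fun w : Cube d => w i) (volume_coord_eq i)
  have huniv : {w : Cube d | w i ≤ 1} = Set.univ := by ext w; simp [unitInterval.le_one']
  simp only [huniv, setIntegral_univ] at hden
  refine hnum.div hden fun p => (integral_pos_of_continuous_cube ?_ fun w => pos _ _).ne'
  exact hF.comp (Continuous.prodMk_right p)

lemma continuous_rosenblatt_single {d : ℕ} {f : Cube d → ℝ} (hf : Continuous f)
    (pos : ∀ y, 0 < f y) : Continuous (rosenblatt f) := by
  refine continuous_pi fun i => ?_
  have := continuous_rosenblatt (X := Unit) (k := fun _ => f) (hf.comp continuous_snd)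
    (fun _ => pos) i
  exact this.comp (Continuous.prodMk_right ())

lemma rosenblatt_congr {d : ℕ} (f : Cube d → ℝ) {y y' : Cube d} {i : Fin d}
    (h : ∀ j ≤ i, y j = y' j) : rosenblatt f y i = rosenblatt f y' i := by
  have hs : splice i y = splice i y' := by
    funext w j
    by_cases hj : j < i
    · simp [splice, hj, h j hj.le]
    · simp [splice, hj]
  simp only [rosenblatt, hs, h i le_rfl]

lemma rosenblatt_of_eq_zero {d : ℕ} (f : Cube d → ℝ) {y : Cube d} {i : Fin d} (h : y i = 0) :
    rosenblatt f y i = 0 := by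
  have : {w : Cube d | w i ≤ 0} = {w | w i = 0} := by
    ext w; simp
  rw [rosenblatt, h, this, setIntegral_measure_zero _ (volume_coord_eq i 0), zero_div]

lemma rosenblatt_of_eq_one {d : ℕ} {f : Cube d → ℝ} (hf : Continuous f) (pos : ∀ y, 0 < f y)
    {y : Cube d} {i : Fin d} (h : y i = 1) : rosenblatt f y i = 1 := by
  have huniv : {w : Cube d | w i ≤ 1} = Set.univ := by ext w; simp [unitInterval.le_one']
  rw [rosenblatt, h, huniv, setIntegral_univ]
  exact div_self (integral_pos_of_continuous_cube
    (hf.comp ((continuous_splice i).comp (Continuous.prodMk_right y))) fun w => pos _).ne'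

lemma rosenblatt_mem_Icc {d : ℕ} {f : Cube d → ℝ} (hf : Continuous f) (pos : ∀ y, 0 < f y)
    (y : Cube d) (i : Fin d) : rosenblatt f y i ∈ Set.Icc (0 : ℝ) 1 := by
  have hc : Continuous fun w => f (splice i y w) :=
    hf.comp ((continuous_splice i).comp (Continuous.prodMk_right y))
  have hp := integral_pos_of_continuous_cube hc fun w => pos _
  refine ⟨div_nonneg (integral_nonneg fun w => (pos _).le) hp.le, (div_le_one hp).2 ?_⟩
  exact setIntegral_le_integral (integrable_of_continuous_cube hc)
    (Eventually.of_forall fun w => (pos _).le)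

/-- Successive inversion of the conditional distribution functions solves `F(y) = u`. -/
lemma rosenblatt_invRosenblatt {d : ℕ} {f : Cube d → ℝ} (hf : Continuous f) (pos : ∀ y, 0 < f y)
    (hmono : ∀ (y : Cube d) (i : Fin d),
      StrictMono fun s : unitInterval => rosenblatt f (Function.update y i s) i)
    {u : Fin d → ℝ} (hu : ∀ i, u i ∈ Set.Icc (0 : ℝ) 1) :
    rosenblatt f (invRosenblatt f u) = u := by
  funext i
  set y := invRosenblatt f u with hy
  set G : unitInterval → ℝ := fun s => rosenblatt f (Function.update y i s) i with hG
  have hGc : Continuous G :=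
    (continuous_apply i).comp ((continuous_rosenblatt_single hf pos).comp
      (continuous_const.update i continuous_id))
  have hGm : StrictMono G := hmono y i
  have hG0 : G 0 = 0 := rosenblatt_of_eq_zero f (by simp)
  have hG1 : G 1 = 1 := rosenblatt_of_eq_one hf pos (by simp)
  obtain ⟨s, hs⟩ : u i ∈ Set.range G :=
    mem_range_of_exists_le_of_exists_ge hGc ⟨0, hG0 ▸ (hu i).1⟩ ⟨1, hG1 ▸ (hu i).2⟩
  have hyi : y i = s := by
    have hset : {s : unitInterval | u i ≤
        rosenblatt f (fun j => if _h : j < i then invRosenblatt f u j else s) i} = Set.Ici s := by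
      ext r
      have : rosenblatt f (fun j => if _h : j < i then invRosenblatt f u j else r) i = G r := by
        refine rosenblatt_congr f fun j hj => ?_
        rcases hj.lt_or_eq with h | rfl
        · simp [h, h.ne, hy]
        · simp
      rw [Set.mem_ofPred_eq, this, ← hs, hGm.le_iff_le, Set.mem_Ici]
    rw [hy, invRosenblatt, hset, csInf_Ici]
  calc rosenblatt f y i = G (y i) := by simp [hG]
    _ = u i := by rw [hyi, hs]

lemma rosenblatt_injective {d : ℕ} {f : Cube d → ℝ}
    (hmono : ∀ (y : Cube d) (i : Fin d),
      StrictMono fun s : unitInterval => rosenblatt f (Function.update y i s) i) :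
    Function.Injective (rosenblatt f) := by
  intro y y' h
  funext i
  induction i using WellFoundedLT.induction with
  | ind i ih =>
    refine (hmono y i).injective ?_
    have h1 : rosenblatt f (Function.update y i (y i)) i = rosenblatt f y i := by simp
    have h2 : rosenblatt f (Function.update y i (y' i)) i = rosenblatt f y' i := by
      refine rosenblatt_congr f fun j hj => ?_
      rcases hj.lt_or_eq with h | rfl
      · simp [h.ne, ih j h]
      · simp
    exact h1.trans ((congrFun h i).trans h2.symm)

/-! ### The Rosenblatt transformation of a density is uniformly distributed -/

lemma measurePreserving_cons {α : Type*} [MeasurableSpace α] (μ : Measure α) [SigmaFinite μ]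
    (n : ℕ) : MeasurePreserving (fun p : α × (Fin n → α) => (Fin.cons p.1 p.2 : Fin (n + 1) → α))
      (μ.prod (Measure.pi fun _ => μ)) (Measure.pi fun _ => μ) := by
  have h := (measurePreserving_piFinSuccAbove (fun _ : Fin (n + 1) => μ) 0).symm
  convert h using 1
  funext p
  simp [MeasurableEquiv.piFinSuccAbove, Fin.insertNthEquiv]

lemma measurableEmbedding_cons {α : Type*} [MeasurableSpace α] (n : ℕ) :
    MeasurableEmbedding (fun p : α × (Fin n → α) => (Fin.cons p.1 p.2 : Fin (n + 1) → α)) := by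
  have h := (MeasurableEquiv.piFinSuccAbove (fun _ : Fin (n + 1) => α) 0).symm.measurableEmbedding
  convert h using 1
  funext p
  simp [MeasurableEquiv.piFinSuccAbove, Fin.insertNthEquiv]

lemma integral_cube_succ {n : ℕ} (F : Cube (n + 1) → ℝ) :
    ∫ y, F y = ∫ p : unitInterval × Cube n, F (Fin.cons p.1 p.2) :=
  ((measurePreserving_cons (volume : Measure unitInterval) n).integral_comp
    (measurableEmbedding_cons n) F).symm

lemma continuous_cons {n : ℕ} :
    Continuous fun p : unitInterval × Cube n => (Fin.cons p.1 p.2 : Cube (n + 1)) := by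
  refine continuous_pi fun j => ?_
  refine Fin.cases ?_ (fun i => ?_) j
  · simpa using continuous_fst
  · simpa using! (continuous_apply i).comp continuous_snd

/-- The marginal density of the first coordinate. -/
noncomputable def firstMarginal {n : ℕ} (f : Cube (n + 1) → ℝ) (s : unitInterval) : ℝ :=
  ∫ w : Cube n, f (Fin.cons s w)

lemma integrable_comp_cons {n : ℕ} {f : Cube (n + 1) → ℝ} (hf : Continuous f) :
    Integrable fun p : unitInterval × Cube n => f (Fin.cons p.1 p.2) :=
  ((measurePreserving_cons (volume : Measure unitInterval) n).integrable_comp_emb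
    (measurableEmbedding_cons n)).2 (integrable_of_continuous_cube hf)

lemma integral_firstMarginal {n : ℕ} {f : Cube (n + 1) → ℝ} (hf : Continuous f) :
    ∫ s, firstMarginal f s = ∫ y, f y := by
  rw [integral_cube_succ]
  exact (integral_prod _ (integrable_comp_cons hf)).symm

lemma continuous_firstMarginal {n : ℕ} {f : Cube (n + 1) → ℝ} (hf : Continuous f) :
    Continuous (firstMarginal f) := by
  have := continuous_parametric_integral_of_continuous (μ := volume)
    (f := fun (s : unitInterval) (w : Cube n) => f (Fin.cons s w)) (hf.comp continuous_cons)
    isCompact_univ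
  simpa [firstMarginal] using! this

lemma firstMarginal_pos {n : ℕ} {f : Cube (n + 1) → ℝ} (hf : Continuous f) (pos : ∀ y, 0 < f y)
    (s : unitInterval) : 0 < firstMarginal f s :=
  integral_pos_of_continuous_cube (hf.comp (continuous_cons.comp (Continuous.prodMk_right s)))
    fun _ => pos _

/-- The first component of the Rosenblatt transformation is the distribution function of the
first marginal. -/
lemma rosenblatt_cons_zero {n : ℕ} {f : Cube (n + 1) → ℝ} (hf : Continuous f)
    (s : unitInterval) (y : Cube n) :
    rosenblatt f (Fin.cons s y) 0 =
      (∫ r in Set.Iic s, firstMarginal f r) / ∫ r, firstMarginal f r := by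
  have hs : ∀ w : Cube (n + 1), splice 0 (Fin.cons s y) w = w := fun w => by
    funext j; simp [splice]
  simp only [rosenblatt, hs, Fin.cons_zero, integral_firstMarginal hf]
  congr 1
  have hm : MeasurableSet {w : Cube (n + 1) | w 0 ≤ s} :=
    (isClosed_le (continuous_apply 0) continuous_const).measurableSet
  rw [← integral_indicator hm, integral_cube_succ, ← integral_indicator measurableSet_Iic]
  have hint : Integrable fun p : unitInterval × Cube n =>
      Set.indicator {w : Cube (n + 1) | w 0 ≤ s} f (Fin.cons p.1 p.2) :=
    ((measurePreserving_cons (volume : Measure unitInterval) n).integrable_comp_emb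
      (measurableEmbedding_cons n)).2 ((integrable_of_continuous_cube hf).indicator hm)
  refine (integral_prod _ hint).trans (integral_congr_ae (Eventually.of_forall fun r => ?_))
  by_cases hr : r ≤ s <;> simp [Set.indicator, hr, firstMarginal]

/-- The other components are the Rosenblatt transformation of the slices of the density. -/
lemma rosenblatt_cons_succ {n : ℕ} {f : Cube (n + 1) → ℝ}
    (s : unitInterval) (y : Cube n) (i : Fin n) :
    rosenblatt f (Fin.cons s y) i.succ = rosenblatt (fun w => f (Fin.cons s w)) y i := by
  have hs : ∀ (r : unitInterval) (w : Cube n),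
      splice i.succ (Fin.cons s y) (Fin.cons r w) = (Fin.cons s (splice i y w) : Cube (n + 1)) := by
    intro r w
    funext j
    refine Fin.cases ?_ (fun j => ?_) j
    · simp [splice]
    · simp [splice]
  have hm : MeasurableSet {w : Cube (n + 1) | w i.succ ≤ y i} :=
    (isClosed_le (continuous_apply _) continuous_const).measurableSet
  have hm' : MeasurableSet {w : Cube n | w i ≤ y i} :=
    (isClosed_le (continuous_apply _) continuous_const).measurableSet
  simp only [rosenblatt, Fin.cons_succ]
  congr 1
  · rw [← integral_indicator hm, integral_cube_succ, ← integral_indicator hm']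
    have : (fun p : unitInterval × Cube n => Set.indicator {w : Cube (n + 1) | w i.succ ≤ y i}
        (fun w => f (splice i.succ (Fin.cons s y) w)) (Fin.cons p.1 p.2)) =
        fun p => Set.indicator {w : Cube n | w i ≤ y i}
          (fun w => f (Fin.cons s (splice i y w))) p.2 := by
      funext p
      simp [Set.indicator, hs]
    rw [this]
    refine (integral_fun_snd (μ := (volume : Measure unitInterval)) _).trans ?_
    simp
  · rw [integral_cube_succ]
    simp only [hs]
    refine (integral_fun_snd (μ := (volume : Measure unitInterval))
      (fun w : Cube n => f (Fin.cons s (splice i y w)))).trans ?_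
    simp

/-- A distribution function on `[0,1]` with a positive density transforms that density into
the uniform distribution. -/
lemma map_cdf_withDensity {g : unitInterval → ℝ} (hg : Continuous g) (pos : ∀ s, 0 < g s) :
    ((volume : Measure unitInterval).withDensity fun s => ENNReal.ofReal (g s)).map
        (fun s => (∫ r in Set.Iic s, g r) / ∫ r, g r) =
      ENNReal.ofReal (∫ r, g r) • volume.restrict (Set.Icc (0 : ℝ) 1) := by
  set G : unitInterval → ℝ := fun s => (∫ r in Set.Iic s, g r) / ∫ r, g r with hG
  have hint : Integrable g := by
    simpa using hg.continuousOn.integrableOn_compact (μ := volume) isCompact_univ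
  have hI : 0 < ∫ r, g r := by
    rw [integral_pos_iff_support_of_nonneg (fun y => (pos y).le) hint]
    have : Function.support g = Set.univ := by ext y; simp [(pos y).ne']
    simp [this]
  have hGc : Continuous G := by
    have := continuous_setIntegral_le (X := unitInterval) (F := fun _ => g)
      (hg.comp continuous_snd) continuous_id continuous_id
      (fun s => by simp)
    exact this.div_const _
  have hGm : StrictMono G := by
    intro s r hsr
    refine div_lt_div_of_pos_right ?_ hI
    have hu : Set.Iic r = Set.Iic s ∪ Set.Ioc s r := (Set.Iic_union_Ioc_eq_Iic hsr.le).symm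
    rw [hu, setIntegral_union (Set.Iic_disjoint_Ioc le_rfl) measurableSet_Ioc hint.integrableOn
      hint.integrableOn]
    refine lt_add_of_pos_right _ ?_
    rw [setIntegral_pos_iff_support_of_nonneg_ae (Eventually.of_forall fun y => (pos y).le)
      hint.integrableOn]
    have : Function.support g = Set.univ := by ext y; simp [(pos y).ne']
    rw [this, Set.univ_inter, unitInterval.volume_Ioc]
    simpa using hsr
  have hG0 : G 0 = 0 := by
    have : Set.Iic (0 : unitInterval) = {0} := by ext; simp
    simp [hG, this]
  have hG1 : G 1 = 1 := by
    have : Set.Iic (1 : unitInterval) = Set.univ := by ext; simp [unitInterval.le_one']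
    simp [hG, this, hI.ne']
  have hfin : IsFiniteMeasure
      ((volume : Measure unitInterval).withDensity fun s => ENNReal.ofReal (g s)) :=
    isFiniteMeasure_withDensity_ofReal hint.2
  refine Measure.ext_of_Iic _ _ fun a => ?_
  rw [Measure.map_apply hGc.measurable measurableSet_Iic]
  have hval : ∀ s : unitInterval, G s = a →
      (volume.withDensity fun s => ENNReal.ofReal (g s)) (G ⁻¹' Set.Iic a) =
        ENNReal.ofReal (∫ r, g r) * ENNReal.ofReal a := by
    intro s hs
    have : G ⁻¹' Set.Iic a = Set.Iic s := by
      ext r; rw [Set.mem_preimage, Set.mem_Iic, ← hs, hGm.le_iff_le, Set.mem_Iic]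
    rw [this, withDensity_apply _ measurableSet_Iic, ← ofReal_integral_eq_lintegral_ofReal
      hint.integrableOn (Eventually.of_forall fun y => (pos y).le), ← ENNReal.ofReal_mul hI.le]
    congr 1
    rw [← hs, hG]
    field_simp
  rw [Measure.smul_apply, smul_eq_mul, Measure.restrict_apply measurableSet_Iic]
  rcases lt_or_ge a 0 with ha | ha
  · have h1 : G ⁻¹' Set.Iic a = ∅ := by
      ext r
      simp only [Set.mem_preimage, Set.mem_Iic, Set.mem_empty_iff_false, iff_false, not_le]
      exact ha.trans_le (hG0 ▸ hGm.monotone unitInterval.nonneg')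
    have h2 : Set.Iic a ∩ Set.Icc 0 1 = ∅ := by
      ext r
      simp only [Set.mem_inter_iff, Set.mem_Iic, Set.mem_Icc, Set.mem_empty_iff_false, iff_false]
      intro h; linarith [h.1, h.2.1]
    simp [h1, h2]
  rcases le_or_gt a 1 with ha1 | ha1
  · obtain ⟨s, hs⟩ : a ∈ Set.range G :=
      mem_range_of_exists_le_of_exists_ge hGc ⟨0, hG0 ▸ ha⟩ ⟨1, hG1 ▸ ha1⟩
    have h2 : Set.Iic a ∩ Set.Icc 0 1 = Set.Icc 0 a := by
      ext r
      simp only [Set.mem_inter_iff, Set.mem_Iic, Set.mem_Icc]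
      constructor
      · intro h; exact ⟨h.2.1, h.1⟩
      · intro h; exact ⟨h.2, h.1, h.2.trans ha1⟩
    rw [hval s hs, h2, Real.volume_Icc, sub_zero]
  · have h1 : G ⁻¹' Set.Iic a = Set.univ := by
      ext r
      simp only [Set.mem_preimage, Set.mem_Iic, Set.mem_univ, iff_true]
      exact (hGm.monotone unitInterval.le_one').trans (hG1.trans_le ha1.le)
    have h2 : Set.Iic a ∩ Set.Icc 0 1 = Set.Icc 0 1 := by
      ext r
      simp only [Set.mem_inter_iff, Set.mem_Iic, Set.mem_Icc, and_iff_right_iff_imp]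
      intro h; linarith [h.2]
    rw [h1, h2, withDensity_apply _ MeasurableSet.univ, Measure.restrict_univ,
      ← ofReal_integral_eq_lintegral_ofReal hint (Eventually.of_forall fun y => (pos y).le)]
    simp

lemma lintegral_comp_cdf {g : unitInterval → ℝ} (hg : Continuous g) (pos : ∀ s, 0 < g s)
    (hGm : Measurable fun s => (∫ r in Set.Iic s, g r) / ∫ r, g r)
    {h : ℝ → ENNReal} (hh : Measurable h) :
    ∫⁻ s, ENNReal.ofReal (g s) * h ((∫ r in Set.Iic s, g r) / ∫ r, g r) =
      ENNReal.ofReal (∫ r, g r) * ∫⁻ r in Set.Icc (0 : ℝ) 1, h r := by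
  rw [← smul_eq_mul, ← lintegral_smul_measure, ← map_cdf_withDensity hg pos,
    lintegral_map hh hGm]
  exact (lintegral_withDensity_eq_lintegral_mul _ (by fun_prop) (hh.comp hGm)).symm

/-- The uniform distribution on `[0,1]^d`, as a measure on `ℝ^d`. -/
noncomputable abbrev unifMeasure (d : ℕ) : Measure (Fin d → ℝ) :=
  Measure.pi fun _ => volume.restrict (Set.Icc (0 : ℝ) 1)

/-- The Rosenblatt transformation maps the distribution with density `f` to the uniform
distribution. The proof splits off the first coordinate. -/
lemma lintegral_comp_rosenblatt {d : ℕ} {f : Cube d → ℝ} (hf : Continuous f) (pos : ∀ y, 0 < f y)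
    {h : (Fin d → ℝ) → ENNReal} (hh : Measurable h) :
    ∫⁻ y, ENNReal.ofReal (f y) * h (rosenblatt f y) =
      ENNReal.ofReal (∫ y, f y) * ∫⁻ u, h u ∂unifMeasure d := by
  induction d with
  | zero =>
    have hv : (volume : Measure (Cube 0)) = Measure.dirac (fun i => i.elim0) :=
      Measure.volume_pi_eq_dirac _
    have hr : rosenblatt f (fun i => i.elim0) = fun i => i.elim0 := Subsingleton.elim _ _
    rw [hv, lintegral_dirac, integral_dirac, unifMeasure,
      Measure.pi_of_empty _ (fun i => i.elim0), lintegral_dirac, hr]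
  | succ n ih =>
    have hcont : ∀ s, Continuous fun w : Cube n => f (Fin.cons s w) := fun s =>
      hf.comp (continuous_cons.comp (Continuous.prodMk_right s))
    have hmeas : Measurable fun y => ENNReal.ofReal (f y) * h (rosenblatt f y) :=
      (ENNReal.measurable_ofReal.comp hf.measurable).mul
        (hh.comp (continuous_rosenblatt_single hf pos).measurable)
    have hGm : Measurable fun s => (∫ r in Set.Iic s, firstMarginal f r) /
        ∫ r, firstMarginal f r := by
      simp only [← rosenblatt_cons_zero hf _ (fun _ => 0)]
      exact ((continuous_apply 0).comp ((continuous_rosenblatt_single hf pos).comp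
        (continuous_cons.comp (Continuous.prodMk_left _)))).measurable
    have hcm : Measurable fun p : ℝ × (Fin n → ℝ) => h (Fin.cons p.1 p.2) :=
      hh.comp (measurableEmbedding_cons n).measurable
    refine ((measurePreserving_cons (volume : Measure unitInterval) n).lintegral_comp
      hmeas).symm.trans ?_
    refine (lintegral_prod _
      ((hmeas.comp (measurableEmbedding_cons n).measurable).aemeasurable)).trans ?_
    have hinner : ∀ s : unitInterval, (∫⁻ w : Cube n, ENNReal.ofReal (f (Fin.cons s w)) *
        h (rosenblatt f (Fin.cons s w))) = ENNReal.ofReal (firstMarginal f s) *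
          ∫⁻ v, h (Fin.cons ((∫ r in Set.Iic s, firstMarginal f r) /
            ∫ r, firstMarginal f r) v) ∂unifMeasure n := by
      intro s
      set G := (∫ r in Set.Iic s, firstMarginal f r) / ∫ r, firstMarginal f r
      rw [firstMarginal, ← ih (hcont s) (fun _ => pos _)
        (h := fun v => h (Fin.cons G v)) (hcm.comp measurable_prodMk_left)]
      refine lintegral_congr fun w => ?_
      congr 2
      funext j
      refine Fin.cases ?_ (fun i => ?_) j
      · simpa using rosenblatt_cons_zero hf s w
      · simpa using rosenblatt_cons_succ s w i
    refine (lintegral_congr hinner).trans ?_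
    rw [lintegral_comp_cdf (continuous_firstMarginal hf) (firstMarginal_pos hf pos) hGm
      (h := fun r => ∫⁻ v, h (Fin.cons r v) ∂unifMeasure n) hcm.lintegral_prod_right',
      integral_firstMarginal hf, unifMeasure,
      ← (measurePreserving_cons (volume.restrict (Set.Icc (0 : ℝ) 1)) n).lintegral_comp hh,
      lintegral_prod _ hcm.aemeasurable]

/-! ### Continuity and distribution of the inverse transformation -/

/-- On `[0,1]^d` the inverse Rosenblatt transformations of a continuous family of positive
densities agree with a map that is continuous jointly in the parameter and the point. -/
lemma exists_continuous_inverse {d : ℕ} {k : Cube d → Cube d → ℝ}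
    (hk : Continuous (Function.uncurry k)) (pos : ∀ x y, 0 < k x y) (hA1 : AssumptionA1 k) :
    ∃ J : Cube d × (Fin d → ℝ) → Cube d, Continuous J ∧
      (∀ x u, (∀ i, u i ∈ Set.Icc (0 : ℝ) 1) → J (x, u) = invRosenblatt (k x) u) ∧
      ∀ x y, J (x, rosenblatt (k x) y) = y := by
  have hkx : ∀ x, Continuous (k x) := fun x => hk.comp (Continuous.prodMk_right x)
  -- The inverse of a continuous bijection between compact Hausdorff spaces is continuous.
  let Φ : Cube d × Cube d → Cube d × Cube d := fun p =>
    (p.1, fun i => ⟨rosenblatt (k p.1) p.2 i, rosenblatt_mem_Icc (hkx _) (pos _) _ _⟩)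
  have hΦc : Continuous Φ := by
    refine continuous_fst.prodMk (continuous_pi fun i => ?_)
    exact (continuous_rosenblatt hk pos i).subtype_mk _
  have hΦval : ∀ p, (fun i => ((Φ p).2 i : ℝ)) = rosenblatt (k p.1) p.2 := fun p => rfl
  have hΦ : Function.Bijective Φ := by
    constructor
    · rintro ⟨x, y⟩ ⟨x', y'⟩ h
      obtain rfl : x = x' := congrArg Prod.fst h
      have h2 : rosenblatt (k x) y = rosenblatt (k x) y' := by
        rw [← hΦval (x, y), ← hΦval (x, y'), h]
      rw [rosenblatt_injective (hA1 x) h2]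
    · rintro ⟨x, v⟩
      refine ⟨(x, invRosenblatt (k x) fun i => v i), ?_⟩
      have := rosenblatt_invRosenblatt (hkx x) (pos x) (hA1 x) (u := fun i => v i)
        fun i => (v i).2
      refine Prod.ext rfl (funext fun i => Subtype.ext ?_)
      exact congrFun this i
  let e := Equiv.ofBijective Φ hΦ
  let E : Cube d × Cube d ≃ₜ Cube d × Cube d := Continuous.homeoOfEquivCompactToT2 (f := e) hΦc
  have hE : ∀ p, E.symm (Φ p) = p := fun p => e.symm_apply_apply p
  let pr : (Fin d → ℝ) → Cube d := fun u i => Set.projIcc 0 1 zero_le_one (u i)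
  have hpr : Continuous pr := continuous_pi fun i => continuous_projIcc.comp (continuous_apply i)
  have hinv : ∀ x y, (E.symm (x, pr (rosenblatt (k x) y))).2 = y := by
    intro x y
    have : (x, pr (rosenblatt (k x) y)) = Φ (x, y) := by
      refine Prod.ext rfl (funext fun i => ?_)
      exact Set.projIcc_of_mem zero_le_one (rosenblatt_mem_Icc (hkx x) (pos x) y i)
    rw [this, hE]
  refine ⟨fun p => (E.symm (p.1, pr p.2)).2, ?_, ?_, hinv⟩
  · exact continuous_snd.comp (E.symm.continuous.comp
      (continuous_fst.prodMk (hpr.comp continuous_snd)))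
  · intro x u hu
    have := hinv x (invRosenblatt (k x) u)
    rwa [rosenblatt_invRosenblatt (hkx x) (pos x) (hA1 x) hu] at this

/-- The inverse Rosenblatt transformation of a uniform random variable has the distribution
`K x`. -/
lemma unifMeasure_preimage_inverse {d : ℕ} {K : Kernel (Cube d) (Cube d)} [IsMarkovKernel K]
    {k : Cube d → Cube d → ℝ} (hK : IsDensity K k) (hk : Continuous (Function.uncurry k))
    (pos : ∀ x y, 0 < k x y) {J : Cube d × (Fin d → ℝ) → Cube d} (hJ : Continuous J)
    (hJF : ∀ x y, J (x, rosenblatt (k x) y) = y) (x : Cube d) {A : Set (Cube d)}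
    (hA : MeasurableSet A) : unifMeasure d {u | J (x, u) ∈ A} = K x A := by
  have hkx : Continuous (k x) := hk.comp (Continuous.prodMk_right x)
  have hS : MeasurableSet {u | J (x, u) ∈ A} :=
    (hJ.comp (Continuous.prodMk_right x)).measurable hA
  have h1 := lintegral_comp_rosenblatt hkx (pos x)
    (h := Set.indicator {u | J (x, u) ∈ A} 1) (measurable_one.indicator hS)
  rw [lintegral_indicator_one hS, ofReal_integral_eq_lintegral_ofReal
    (integrable_of_continuous_cube hkx) (Eventually.of_forall fun y => (pos x y).le)] at h1
  have h2 : ∫⁻ y, ENNReal.ofReal (k x y) = 1 := by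
    rw [← setLIntegral_univ, ← withDensity_apply _ MeasurableSet.univ, ← hK x]
    exact measure_univ
  rw [h2, one_mul] at h1
  rw [← h1, hK x, withDensity_apply _ hA, ← lintegral_indicator hA]
  refine lintegral_congr fun y => ?_
  by_cases hy : y ∈ A <;> simp [Set.indicator, hJF, hy]

lemma exists_kernel_bound {d : ℕ} {K : Kernel (Cube d) (Cube d)} {k : Cube d → Cube d → ℝ}
    (hK : IsDensity K k) (hk : Continuous (Function.uncurry k)) :
    ∃ C : ENNReal, C ≠ ⊤ ∧ ∀ x A, MeasurableSet A → K x A ≤ C * volume A := by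
  obtain ⟨B, hB⟩ := (isCompact_range hk).isBounded.exists_norm_le
  refine ⟨ENNReal.ofReal B, ENNReal.ofReal_ne_top, fun x A hA => ?_⟩
  rw [hK x, withDensity_apply _ hA, ← setLIntegral_const]
  refine lintegral_mono fun y => ENNReal.ofReal_le_ofReal ?_
  exact (le_abs_self _).trans (hB _ ⟨(x, y), rfl⟩)

lemma kernel_lower_bound {d : ℕ} {K : Kernel (Cube d) (Cube d)} {k : Cube d → Cube d → ℝ}
    (hK : IsDensity K k) {c : ℝ} (hc : ∀ x y, c ≤ k x y) (x : Cube d) {A : Set (Cube d)}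
    (hA : MeasurableSet A) : ENNReal.ofReal c * volume A ≤ K x A := by
  rw [hK x, withDensity_apply _ hA, ← setLIntegral_const]
  exact lintegral_mono fun y => ENNReal.ofReal_le_ofReal (hc x y)

/-! ### Digits -/

lemma exists_truncation_eq {b : ℕ} {a : ℕ → ℕ} (hb : 2 ≤ b) (ha : ∀ k, a k < b) (R : ℕ) :
    ∃ D < b ^ R, ∑ k ∈ Finset.range R, (a k : ℝ) / (b : ℝ) ^ (k + 1) = (D : ℝ) / (b : ℝ) ^ R := by
  have hb0 : (b : ℝ) ≠ 0 := by positivity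
  induction R with
  | zero => exact ⟨0, by simp, by simp⟩
  | succ R ih =>
    obtain ⟨D, hD, hs⟩ := ih
    refine ⟨b * D + a R, ?_, ?_⟩
    · calc b * D + a R < b * D + b := by have := ha R; omega
        _ = b * (D + 1) := by ring
        _ ≤ b * b ^ R := Nat.mul_le_mul_left _ hD
        _ = b ^ (R + 1) := by ring
    · rw [Finset.sum_range_succ, hs]
      push_cast
      field_simp
      ring

lemma truncation_le_tsum {b : ℕ} {a : ℕ → ℕ} (ha : ∀ k, a k < b) (R : ℕ) :
    ∑ k ∈ Finset.range R, (a k : ℝ) / (b : ℝ) ^ (k + 1) ≤ ∑' k, (a k : ℝ) / (b : ℝ) ^ (k + 1) ∧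
    ∑' k, (a k : ℝ) / (b : ℝ) ^ (k + 1) ≤
      ∑ k ∈ Finset.range R, (a k : ℝ) / (b : ℝ) ^ (k + 1) + 1 / (b : ℝ) ^ R := by
  have hterm : ∀ k, (a k : ℝ) / (b : ℝ) ^ (k + 1) =
      Real.ofDigitsTerm (fun k => (⟨a k, ha k⟩ : Fin b)) k := by
    intro k
    simp [Real.ofDigitsTerm, div_eq_mul_inv]
  simp only [hterm]
  have h := Real.ofDigits_eq_sum_add_ofDigits (fun k => (⟨a k, ha k⟩ : Fin b)) R
  have h0 := Real.ofDigits_nonneg fun i => (⟨a (i + R), ha _⟩ : Fin b)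
  have h1 := Real.ofDigits_le_one fun i => (⟨a (i + R), ha _⟩ : Fin b)
  rw [Real.ofDigits] at h
  have hb : (0 : ℝ) ≤ ((b : ℝ) ^ R)⁻¹ := by positivity
  rw [h]
  constructor
  · nlinarith
  · rw [one_div]; nlinarith

/-- In every aligned block of `b ^ (t + s * (R + 1))` indices, the truncations after `R` digits of
a `(t,s)`-sequence take all their possible values. Boxes of side `b^{-(R+1)}` that keep away from
the lower faces of the boxes of side `b^{-R}` are used, since a point on such a face may be written
with a tail of digits `b - 1`, and then its truncation belongs to the neighbouring box. -/
lemma exists_truncation_mem {s b t R : ℕ} {a : ℕ → ℕ → Fin s → ℕ} {D : ℕ → Fin s → ℕ}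
    (ha : ∀ n k i, a n k i < b)
    (hseq : IsTSSequence b t (fun n i => ∑' k : ℕ, (a n k i : ℝ) / (b : ℝ) ^ (k + 1)))
    (hD : ∀ n i, ∑ k ∈ Finset.range R, (a n k i : ℝ) / (b : ℝ) ^ (k + 1) =
      (D n i : ℝ) / (b : ℝ) ^ R)
    (q : ℕ) {c : Fin s → ℕ} (hc : ∀ i, c i < b ^ R) :
    ∃ n < b ^ (t + s * (R + 1)), D (q * b ^ (t + s * (R + 1)) + n) = c := by
  classical
  obtain ⟨hb, -, -, -, hnet⟩ := hseq q (t + s * (R + 1)) (Nat.le_add_right _ _)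
  have hcard := hnet (fun i => b * c i + 1) (fun _ => R + 1) (fun i => by
    calc b * c i + 1 < b * c i + b := by omega
      _ = b * (c i + 1) := by ring
      _ ≤ b * b ^ R := Nat.mul_le_mul_left _ (hc i)
      _ = b ^ (R + 1) := by ring) (by simp; ring)
  have hne := Finset.card_pos.1 (hcard.symm ▸ Nat.pow_pos (n := t) (by omega : 0 < b))
  obtain ⟨n, hn⟩ := hne
  rw [Finset.mem_filter, Finset.mem_range] at hn
  refine ⟨n, hn.1, funext fun i => ?_⟩
  obtain ⟨h1, h2⟩ := hn.2 i
  set N := q * b ^ (t + s * (R + 1)) + n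
  obtain ⟨h3, h4⟩ := truncation_le_tsum (a := fun k => a N k i) (fun k => ha N k i) R
  rw [hD] at h3 h4
  have hb0 : (0 : ℝ) < b := by positivity
  have hbR : (0 : ℝ) < (b : ℝ) ^ R := by positivity
  have hb2 : (2 : ℝ) ≤ b := by exact_mod_cast hb
  have e1 := h1.trans h4
  have e2 := h3.trans_lt h2
  rw [← add_div, pow_succ, div_le_div_iff₀ (by positivity) hbR] at e1
  rw [pow_succ, div_lt_div_iff₀ hbR (by positivity)] at e2
  push_cast at e1 e2
  have e1' : (b : ℝ) * c i + 1 ≤ (D N i + 1) * b := by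
    by_contra h
    nlinarith
  have e2' : (D N i : ℝ) * b < b * c i + 1 + 1 := by
    by_contra h
    nlinarith
  have f1 : (c i : ℝ) < D N i + 1 := by
    by_contra h
    nlinarith
  have f2 : (D N i : ℝ) < c i + 1 := by
    by_contra h
    nlinarith
  have g1 : c i < D N i + 1 := by exact_mod_cast f1
  have g2 : D N i < c i + 1 := by exact_mod_cast f2
  omega

/-! ### The distribution of the partially random points -/

lemma unifMeasure_eq_restrict (d : ℕ) :
    unifMeasure d = volume.restrict (Set.pi Set.univ fun _ : Fin d => Set.Ico (0 : ℝ) 1) := by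
  rw [unifMeasure, ← Measure.restrict_congr_set (Ico_ae_eq_Icc (μ := volume) (a := (0 : ℝ)) (b := 1)),
    volume_pi, Measure.restrict_pi_pi]

/-- The uniform distribution on the box with index `D` is `b^{dR}` times Lebesgue measure. -/
lemma unifMeasure_preimage_affine {d b R : ℕ} (hb : 2 ≤ b) (D : Fin d → ℕ) {S : Set (Fin d → ℝ)}
    (hS : MeasurableSet S) :
    unifMeasure d {z | (fun i => (D i : ℝ) / (b : ℝ) ^ R + z i / (b : ℝ) ^ R) ∈ S} =
      ENNReal.ofReal (((b : ℝ) ^ R) ^ d) * volume (S ∩ bBox b D fun _ => R) := by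
  have hr : (0 : ℝ) < (b : ℝ) ^ R := by positivity
  set r : ℝ := (b : ℝ) ^ R with hrdef
  set T : (Fin d → ℝ) → Fin d → ℝ := fun z i => (D i : ℝ) / r + z i / r with hT
  have hTm : Measurable T := by fun_prop
  have hbox : T ⁻¹' (bBox b D fun _ => R) = Set.pi Set.univ fun _ : Fin d => Set.Ico (0 : ℝ) 1 := by
    ext z
    simp only [Set.mem_preimage, bBox, Set.mem_ofPred_eq, Set.mem_pi, Set.mem_univ, true_imp_iff,
      Set.mem_Ico, hT, ← hrdef]
    refine forall_congr' fun i => ?_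
    rw [← add_div, div_le_div_iff_of_pos_right hr, div_lt_div_iff_of_pos_right hr]
    constructor <;> rintro ⟨h1, h2⟩ <;> constructor <;> linarith
  have hsplit : T ⁻¹' (S ∩ bBox b D fun _ => R) =
      (fun z => r⁻¹ • z) ⁻¹' ((fun z => (fun i => (D i : ℝ) / r) + z) ⁻¹'
        (S ∩ bBox b D fun _ => R)) := by
    ext z
    have : (fun i => (D i : ℝ) / r) + r⁻¹ • z = T z := by
      funext i; simp [hT]; ring
    simp only [Set.mem_preimage, this]
  change unifMeasure d (T ⁻¹' S) = _
  rw [unifMeasure_eq_restrict, Measure.restrict_apply (hTm hS), ← hbox, ← Set.preimage_inter,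
    hsplit, Measure.addHaar_preimage_smul _ (inv_ne_zero hr.ne'), measure_preimage_add]
  congr 2
  rw [Module.finrank_fin_fun, inv_pow, inv_inv, abs_of_pos (by positivity)]

/-- What the convergence proof uses about a `(t,d)_R`-sequence: the points have bounded densities,
and the mixture of the distributions of an aligned block of points dominates a multiple of the
uniform distribution. -/
lemma IsTSRSequence.exists_bounds {Ω : Type*} [MeasurableSpace Ω] {P : Measure Ω}
    [IsProbabilityMeasure P] {d b t R : ℕ} {u : ℕ → Ω → Fin d → ℝ}
    (hu : IsTSRSequence P b t R u) :
    ∃ (L : ℕ) (C : ENNReal), 0 < L ∧ C ≠ ⊤ ∧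
      (∀ n ω i, u n ω i ∈ Set.Icc (0 : ℝ) 1) ∧
      (∀ n, Measurable (u n)) ∧
      (∀ n S, MeasurableSet S → P {ω | u n ω ∈ S} ≤ C * unifMeasure d S) ∧
      (∀ q S, MeasurableSet S →
        unifMeasure d S ≤ ∑ j ∈ Finset.range L, P {ω | u (q * L + j) ω ∈ S}) := by
  obtain ⟨a, z, ha, hseq, hzm, hz01, hzlaw, hzind, huz⟩ := hu
  have hb : 2 ≤ b := (hseq 0 t le_rfl).1
  have hex : ∀ n i, ∃ D < b ^ R, ∑ k ∈ Finset.range R, (a n k i : ℝ) / (b : ℝ) ^ (k + 1) =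
      (D : ℝ) / (b : ℝ) ^ R := fun n i => exists_truncation_eq hb (fun k => ha n k i) R
  choose D hDlt hD using hex
  have hr : (0 : ℝ) < (b : ℝ) ^ R := by positivity
  have hr1 : (1 : ℝ) ≤ (b : ℝ) ^ R := one_le_pow₀ (by exact_mod_cast (by omega : 1 ≤ b))
  have hu_eq : ∀ n ω, u n ω = fun i => (D n i : ℝ) / (b : ℝ) ^ R + z n i ω / (b : ℝ) ^ R := by
    intro n ω
    funext i
    rw [huz, hD]
  have hzv : ∀ n, Measurable fun ω i => z n i ω := fun n => measurable_pi_lambda _ (hzm n)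
  have hlaw : ∀ n, P.map (fun ω i => z n i ω) = unifMeasure d := by
    intro n
    have h1 : iIndepFun (fun i : Fin d => z n i) P :=
      hzind.precomp (g := fun i : Fin d => (n, i)) fun i j h => congrArg Prod.snd h
    rw [(iIndepFun_iff_map_fun_eq_pi_map fun i => (hzm n i).aemeasurable).1 h1, unifMeasure]
    simp only [hzlaw, Measure.restrict_congr_set (Ico_ae_eq_Icc (μ := volume) (a := (0 : ℝ)) (b := 1))]
  have hprob : ∀ n S, MeasurableSet S → P {ω | u n ω ∈ S} =
      ENNReal.ofReal (((b : ℝ) ^ R) ^ d) * volume (S ∩ bBox b (D n) fun _ => R) := by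
    intro n S hS
    rw [← unifMeasure_preimage_affine hb (D n) hS, ← hlaw n]
    simp only [hu_eq]
    exact (Measure.map_apply (hzv n) ((by fun_prop : Measurable fun (z : Fin d → ℝ) i =>
      (D n i : ℝ) / (b : ℝ) ^ R + z i / (b : ℝ) ^ R) hS)).symm
  have hlt : ∀ n i, ((D n i : ℝ) + 1) / (b : ℝ) ^ R ≤ 1 := by
    intro n i
    rw [div_le_one hr]
    exact_mod_cast hDlt n i
  refine ⟨b ^ (t + d * (R + 1)), ENNReal.ofReal (((b : ℝ) ^ R) ^ d), by positivity,
    ENNReal.ofReal_ne_top, ?_, ?_, ?_, ?_⟩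
  · intro n ω i
    rw [hu_eq]
    obtain ⟨h0, h1⟩ := hz01 n i ω
    refine ⟨by positivity, le_trans ?_ (hlt n i)⟩
    change (D n i : ℝ) / (b : ℝ) ^ R + z n i ω / (b : ℝ) ^ R ≤ _
    rw [← add_div]
    exact div_le_div_of_nonneg_right (by linarith) hr.le
  · intro n
    have : u n = fun ω i => (D n i : ℝ) / (b : ℝ) ^ R + z n i ω / (b : ℝ) ^ R :=
      funext (hu_eq n)
    rw [this]
    exact measurable_pi_lambda _ fun i => ((hzm n i).div_const _).const_add _
  · intro n S hS
    rw [hprob n S hS, unifMeasure_eq_restrict, Measure.restrict_apply hS]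
    gcongr
    intro v hv i _
    exact ⟨(by positivity : (0 : ℝ) ≤ (D n i : ℝ) / (b : ℝ) ^ R).trans (hv i).1,
      (hv i).2.trans_le (hlt n i)⟩
  · intro q S hS
    rw [unifMeasure_eq_restrict, Measure.restrict_apply hS]
    set L := b ^ (t + d * (R + 1))
    have hcover : S ∩ (Set.pi Set.univ fun _ : Fin d => Set.Ico (0 : ℝ) 1) ⊆
        ⋃ j ∈ Finset.range L, S ∩ bBox b (D (q * L + j)) fun _ => R := by
      rintro v ⟨hvS, hv⟩
      have hv' : ∀ i, v i ∈ Set.Ico (0 : ℝ) 1 := fun i => hv i trivial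
      obtain ⟨j, hj, hjD⟩ := exists_truncation_mem ha hseq hD q
        (c := fun i => ⌊v i * (b : ℝ) ^ R⌋₊) fun i => by
          rw [Nat.floor_lt (mul_nonneg (hv' i).1 hr.le)]
          push_cast
          nlinarith [(hv' i).2]
      refine Set.mem_iUnion₂.2 ⟨j, Finset.mem_range.2 hj, hvS, fun i => ?_⟩
      rw [hjD]
      refine ⟨?_, ?_⟩
      · rw [div_le_iff₀ hr]
        exact Nat.floor_le (mul_nonneg (hv' i).1 hr.le)
      · rw [lt_div_iff₀ hr]
        exact Nat.lt_floor_add_one _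
    refine (measure_mono hcover).trans ((measure_biUnion_finset_le _ _).trans ?_)
    refine Finset.sum_le_sum fun j _ => ?_
    rw [hprob _ S hS]
    refine le_mul_of_one_le_left zero_le ?_
    rw [← ENNReal.ofReal_one]
    exact ENNReal.ofReal_le_ofReal (one_le_pow₀ hr1)

/-! ### Non-anticipating sequences do not remain in small sets -/

/-- Disintegration of a random pair whose second component is independent of a `σ`-algebra `m`, on
an event of `m`. -/
lemma measure_inter_eq_lintegral {Ω X Y : Type*} {m : MeasurableSpace Ω}
    [mΩ : MeasurableSpace Ω] [MeasurableSpace X] [MeasurableSpace Y] {P : Measure Ω}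
    [IsProbabilityMeasure P]
    (hm : m ≤ mΩ) {x : Ω → X} {u : Ω → Y} (hx : Measurable[m] x) (hu : Measurable u)
    (hind : Indep (MeasurableSpace.comap u inferInstance) m P) {G : Set Ω}
    (hG : MeasurableSet[m] G) {W : Set (X × Y)} (hW : MeasurableSet W) :
    P (G ∩ {ω | (x ω, u ω) ∈ W}) = ∫⁻ ω in G, P {ω' | (x ω, u ω') ∈ W} ∂P := by
  have hx' : Measurable x := hx.mono hm le_rfl
  have hprod : ((P.restrict G).map x).prod (P.map u) =
      (P.restrict G).map fun ω => (x ω, u ω) := by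
    have : IsProbabilityMeasure (P.map u) := Measure.isProbabilityMeasure_map hu.aemeasurable
    refine Measure.prod_eq fun s t hs ht => ?_
    rw [Measure.map_apply (hx'.prodMk hu) (hs.prod ht), Measure.map_apply hx' hs,
      Measure.map_apply hu ht, Measure.restrict_apply ((hx'.prodMk hu) (hs.prod ht)),
      Measure.restrict_apply (hx' hs)]
    have hset : (fun ω => (x ω, u ω)) ⁻¹' s ×ˢ t ∩ G = u ⁻¹' t ∩ (x ⁻¹' s ∩ G) := by
      ext ω
      simp only [Set.mem_inter_iff, Set.mem_preimage, Set.mem_prod]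
      tauto
    rw [hset, (Indep_iff _ _ _).1 hind _ _ ⟨t, ht, rfl⟩ ((hx hs).inter hG), mul_comm]
  have hpm : Measurable fun ω => (x ω, u ω) := hx'.prodMk hu
  calc P (G ∩ {ω | (x ω, u ω) ∈ W}) = (P.restrict G) ((fun ω => (x ω, u ω)) ⁻¹' W) := by
        rw [Measure.restrict_apply (hpm hW), Set.inter_comm]; rfl
    _ = ((P.restrict G).map x).prod (P.map u) W := by
        rw [hprod, Measure.map_apply hpm hW]
    _ = ∫⁻ ω in G, P.map u (Prod.mk (x ω) ⁻¹' W) ∂P := by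
        rw [Measure.prod_apply hW, lintegral_map (measurable_measure_prodMk_left hW) hx']
    _ = ∫⁻ ω in G, P {ω' | (x ω, u ω') ∈ W} ∂P := by
        refine lintegral_congr fun ω => ?_
        rw [Measure.map_apply hu (measurable_prodMk_left hW)]
        rfl

/-- If a non-anticipating sequence `x` can remain in `A` only by standing still while all
candidates `J (x, u)` miss `H`, or by a candidate in `A`, and `A` is small as compared
with `H`, then it almost surely does not remain in `A` from any given time on. -/
lemma measure_stay_eq_zero {d : ℕ} {Ω : Type*} [mΩ : MeasurableSpace Ω] {P : Measure Ω}
    [IsProbabilityMeasure P] {𝓕 : Filtration ℕ mΩ} {u : ℕ → Ω → Fin d → ℝ}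
    {x : ℕ → Ω → Cube d} (hu : ∀ n, Measurable (u n))
    (hind : ∀ n, Indep (MeasurableSpace.comap (u (n + 1)) inferInstance) (𝓕 n) P)
    (hx : ∀ n, Measurable[𝓕 n] (x n))
    {J : Cube d × (Fin d → ℝ) → Cube d} (hJ : Measurable J)
    {A H : Set (Cube d)} (hA : MeasurableSet A) (hH : MeasurableSet H)
    {L : ℕ} (hL : 0 < L) {β p : ENNReal} (hβ : β ≠ ⊤) (hp : p ≠ ⊤) (hp0 : p ≠ 0)
    (hsmall : 2 * (L * L * β) ≤ p)
    (hupper : ∀ n y, P {ω | J (y, u n ω) ∈ A} ≤ β)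
    (hlower : ∀ q y, p ≤ ∑ j ∈ Finset.range L, P {ω | J (y, u (q * L + j) ω) ∈ H})
    (hstep : ∀ n ω, x n ω ∈ A → x (n + 1) ω ∈ A →
      J (x n ω, u (n + 1) ω) ∈ A ∨ (x (n + 1) ω = x n ω ∧ J (x n ω, u (n + 1) ω) ∉ H))
    (N : ℕ) : P {ω | ∀ n, N ≤ n → x n ω ∈ A} = 0 := by
  have hxm : ∀ n, Measurable (x n) := fun n => (hx n).mono (𝓕.le n) le_rfl
  -- `G q` is the event that `x` remains in `A` from time `N` up to the end of block `q - 1`.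
  let G : ℕ → Set Ω := fun q => {ω | ∀ n, N ≤ n → n < q * L → x n ω ∈ A}
  have hGm : ∀ q n₀, n₀ + 1 = q * L → MeasurableSet[𝓕 n₀] (G q) := by
    intro q n₀ hn₀
    have : G q = ⋂ n, ⋂ (_ : N ≤ n), ⋂ (_ : n < q * L), x n ⁻¹' A := by
      ext ω; simp [G]
    rw [this]
    refine MeasurableSet.iInter fun n => MeasurableSet.iInter fun _ =>
      MeasurableSet.iInter fun hn => 𝓕.mono (by omega : n ≤ n₀) _ (hx n hA)
  have hind' : ∀ n₀ j, Indep (MeasurableSpace.comap (u (n₀ + j + 1)) inferInstance) (𝓕 n₀) P :=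
    fun n₀ j => indep_of_indep_of_le_right (hind (n₀ + j)) (𝓕.mono (Nat.le_add_right _ _))
  have hstep_block : ∀ q, N < q * L →
      (L : ℝ) * P.real (G (q + 1)) ≤ (L - p.toReal / 2) * P.real (G q) := by
    intro q hq
    obtain ⟨n₀, hn₀⟩ : ∃ n₀, n₀ + 1 = q * L := ⟨q * L - 1, by omega⟩
    have hGq := hGm q n₀ hn₀
    have hGq' : MeasurableSet (G q) := 𝓕.le n₀ _ hGq
    -- Given that `x` is still in `A` just before block `q`: the `j`-th candidate of the block lies
    -- in `A` (`bad`), or would lie in `H` if `x` had stood still since then (`hit`).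
    let bad : ℕ → Set Ω := fun j => G q ∩ {ω | J (x (n₀ + j) ω, u (n₀ + j + 1) ω) ∈ A}
    let hit : ℕ → Set Ω := fun j => G q ∩ {ω | J (x n₀ ω, u (n₀ + j + 1) ω) ∈ H}
    have hbad : ∀ j, P (bad j) ≤ β * P (G q) := by
      intro j
      have := measure_inter_eq_lintegral (𝓕.le (n₀ + j)) (hx (n₀ + j)) (hu _) (hind (n₀ + j))
        (𝓕.mono (Nat.le_add_right n₀ j) _ hGq) (hJ hA)
      refine (this.le.trans (lintegral_mono fun ω => hupper _ _)).trans ?_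
      rw [setLIntegral_const]
    have hhitm : ∀ j, MeasurableSet (hit j) := fun j =>
      hGq'.inter ((hJ.comp ((hxm n₀).prodMk (hu _))) hH)
    have hhit : p * P (G q) ≤ ∑ j ∈ Finset.range L, P (hit j) := by
      have : ∀ j, P (hit j) = ∫⁻ ω in G q, P {ω' | J (x n₀ ω, u (q * L + j) ω') ∈ H} ∂P := by
        intro j
        have := measure_inter_eq_lintegral (𝓕.le n₀) (hx n₀) (hu _) (hind' n₀ j) hGq (hJ hH)
        rw [← hn₀, add_right_comm n₀ 1 j]
        exact this
      have hmeas : ∀ j, Measurable fun ω => P {ω' | J (x n₀ ω, u (q * L + j) ω') ∈ H} := by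
        intro j
        exact (measurable_measure_prodMk_left
          (s := {r : Cube d × Ω | J (r.1, u (q * L + j) r.2) ∈ H})
          ((hJ.comp (measurable_fst.prodMk ((hu _).comp measurable_snd))) hH)).comp (hxm n₀)
      simp only [this]
      rw [← lintegral_finsetSum _ fun j _ => hmeas j, ← setLIntegral_const]
      exact lintegral_mono fun ω => hlower q _
    have hhit' : p * P (G q) ≤ L * P (⋃ j ∈ Finset.range L, hit j) := by
      refine hhit.trans ((Finset.sum_le_card_nsmul (Finset.range L) _ _ fun j hj =>
        measure_mono (Set.subset_biUnion_of_mem (u := hit) hj)).trans_eq ?_)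
      rw [Finset.card_range, nsmul_eq_mul]
      rfl
    have hUm : MeasurableSet (⋃ j ∈ Finset.range L, hit j) :=
      Finset.measurableSet_biUnion _ fun j _ => hhitm j
    have hUG : (⋃ j ∈ Finset.range L, hit j) ⊆ G q :=
      Set.iUnion₂_subset fun j _ => Set.inter_subset_left
    have hsub : G (q + 1) ⊆ (⋃ j ∈ Finset.range L, bad j) ∪
        (G q \ ⋃ j ∈ Finset.range L, hit j) := by
      intro ω hω
      have hωq : ω ∈ G q := fun n hn hn' => hω n hn (by
        rw [Nat.add_mul]; omega)
      have hωA : ∀ j ≤ L, x (n₀ + j) ω ∈ A := fun j hj => hω _ (by omega) (by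
        rw [Nat.add_mul]; omega)
      by_cases hb : ω ∈ ⋃ j ∈ Finset.range L, bad j
      · exact Or.inl hb
      refine Or.inr ⟨hωq, ?_⟩
      have hnb : ∀ j < L, J (x (n₀ + j) ω, u (n₀ + j + 1) ω) ∉ A := fun j hj h =>
        hb (Set.mem_iUnion₂.2 ⟨j, Finset.mem_range.2 hj, hωq, h⟩)
      have hst : ∀ j < L, x (n₀ + j + 1) ω = x (n₀ + j) ω ∧
          J (x (n₀ + j) ω, u (n₀ + j + 1) ω) ∉ H := fun j hj =>
        (hstep (n₀ + j) ω (hωA j hj.le) (hωA (j + 1) hj)).resolve_left (hnb j hj)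
      have hconst : ∀ j ≤ L, x (n₀ + j) ω = x n₀ ω := by
        intro j
        induction j with
        | zero => intro _; rfl
        | succ j ih => intro hj; exact (hst j hj).1.trans (ih (by omega))
      intro hh
      obtain ⟨j, hj, -, hjH⟩ := Set.mem_iUnion₂.1 hh
      have hj' := Finset.mem_range.1 hj
      refine (hst j hj').2 ?_
      rw [hconst j hj'.le]
      exact hjH
    have hB : P (⋃ j ∈ Finset.range L, bad j) ≤ L * (β * P (G q)) := by
      refine (measure_biUnion_finset_le _ _).trans ?_
      refine (Finset.sum_le_card_nsmul _ _ _ fun j _ => hbad j).trans ?_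
      rw [Finset.card_range, nsmul_eq_mul]
    have r1 : P.real (G (q + 1)) ≤ P.real (⋃ j ∈ Finset.range L, bad j) +
        P.real (G q \ ⋃ j ∈ Finset.range L, hit j) :=
      (measureReal_mono hsub).trans (measureReal_union_le _ _)
    have r2 := measureReal_sdiff (μ := P) hUG hUm
    have r3 : P.real (⋃ j ∈ Finset.range L, bad j) ≤ L * (β.toReal * P.real (G q)) := by
      have := ENNReal.toReal_mono (by finiteness) hB
      simpa [ENNReal.toReal_mul, measureReal_def] using this
    have r4 : p.toReal * P.real (G q) ≤ L * P.real (⋃ j ∈ Finset.range L, hit j) := by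
      have := ENNReal.toReal_mono (ENNReal.mul_ne_top (ENNReal.natCast_ne_top L)
        (measure_ne_top P _)) hhit'
      simpa [ENNReal.toReal_mul, measureReal_def] using this
    have r5 : 2 * (L * L * β.toReal) ≤ p.toReal := by
      have := ENNReal.toReal_mono hp hsmall
      simpa [ENNReal.toReal_mul] using this
    have r6 := mul_le_mul_of_nonneg_right r5 (measureReal_nonneg (μ := P) (s := G q))
    have hL0 : (0 : ℝ) < L := by exact_mod_cast hL
    rw [r2] at r1
    have r7 := mul_le_mul_of_nonneg_left (r1.trans (add_le_add_left r3 _)) hL0.le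
    linarith
  have hsubG : ∀ q, {ω | ∀ n, N ≤ n → x n ω ∈ A} ⊆ G q := fun q ω hω n hn _ => hω n hn
  set e := P.real {ω | ∀ n, N ≤ n → x n ω ∈ A} with he
  have hL0 : (0 : ℝ) < L := by exact_mod_cast hL
  have hp' : 0 < p.toReal := ENNReal.toReal_pos hp0 hp
  have hdecay : ∀ n, P.real (G (N + 1 + n)) ≤ 1 - n * (p.toReal / (2 * L) * e) := by
    intro n
    induction n with
    | zero => simp
    | succ n ih =>
      have h1 := hstep_block (N + 1 + n) (by nlinarith)
      have h2 : e ≤ P.real (G (N + 1 + n)) := measureReal_mono (hsubG _)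
      have h3 : P.real (G (N + 1 + n + 1)) ≤
          P.real (G (N + 1 + n)) - p.toReal / (2 * L) * P.real (G (N + 1 + n)) := by
        rw [← mul_le_mul_iff_right₀ hL0]
        refine h1.trans (le_of_eq ?_)
        field_simp
      have h4 := mul_le_mul_of_nonneg_left h2 (by positivity : 0 ≤ p.toReal / (2 * L))
      push_cast
      rw [← add_assoc]
      linarith
  -- The probabilities of `G q` are at least `e`, so each block takes a multiple of `e` away.
  have he0 : e = 0 := by
    by_contra hne
    have hpos : 0 < e := lt_of_le_of_ne measureReal_nonneg (Ne.symm hne)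
    obtain ⟨n, hn⟩ := exists_nat_gt (1 / (p.toReal / (2 * L) * e))
    rw [div_lt_iff₀ (by positivity)] at hn
    have := hdecay n
    have h0 := measureReal_nonneg (μ := P) (s := G (N + 1 + n))
    linarith
  exact (measureReal_eq_zero_iff).1 he0

/-! ### Almost sure convergence for partially random points -/

instance : (volume : Measure unitInterval).IsOpenPosMeasure := by
  refine ⟨fun U hU hne h0 => ?_⟩
  obtain ⟨V, hV, rfl⟩ := isOpen_induced_iff.1 hU
  obtain ⟨s, hs⟩ := hne
  have hcl : (s : ℝ) ∈ closure (Set.Ioo (0 : ℝ) 1) := by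
    rw [closure_Ioo zero_ne_one]
    exact s.2
  have hpos := (hV.inter isOpen_Ioo).measure_pos volume (mem_closure_iff.1 hcl V hV hs)
  rw [unitInterval.volume_apply] at h0
  refine hpos.ne' (measure_mono_null ?_ h0)
  rintro r ⟨hrV, hr⟩
  exact ⟨⟨r, hr.1.le, hr.2.le⟩, hrV, rfl⟩

lemma bddAbove_range_of_continuous_cube {d : ℕ} {φ : Cube d → ℝ} (hφ : Continuous φ) :
    BddAbove (Set.range φ) := (isCompact_range hφ).bddAbove

/-- Along a trajectory with summable thresholds, the objective converges to one of its values: up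
to a convergent series it increases. -/
lemma IsRun.exists_tendsto {d : ℕ} {k : Cube d → Cube d → ℝ} {φ : Cube d → ℝ}
    (hφ : Continuous φ) {u : ℕ → Fin d → ℝ} {l : ℕ → ℝ} {x : ℕ → Cube d}
    (hrun : IsRun k φ u l x) (hl : Summable fun n => (l (n + 1))⁻¹) :
    ∃ z, Tendsto (fun n => φ (x n)) atTop (𝓝 (φ z)) := by
  have hlpos : ∀ n, 0 < l (n + 1) := by
    intro n
    induction n with
    | zero => exact hrun.l_pos
    | succ n ih => exact ih.trans_le (hrun.l_mono _ (by omega))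
  have hstep : ∀ n, φ (x n) - (l (n + 1))⁻¹ ≤ φ (x (n + 1)) := by
    intro n
    have hinv := inv_pos.2 (hlpos n)
    rcases hrun.step n with h | h
    · rw [h]; linarith
    · by_contra hlt
      rw [not_le, h] at hlt
      have := hrun.reject n hlt
      rw [← h, this] at hlt
      linarith
  obtain ⟨B, hB⟩ := bddAbove_range_of_continuous_cube hφ
  let s : ℕ → ℝ := fun n => φ (x n) + ∑ j ∈ Finset.range n, (l (j + 1))⁻¹
  have hs : Monotone s := monotone_nat_of_le_succ fun n => by
    have := hstep n
    simp only [s, Finset.sum_range_succ]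
    linarith
  have hsB : BddAbove (Set.range s) := by
    refine ⟨B + ∑' n, (l (n + 1))⁻¹, ?_⟩
    rintro _ ⟨n, rfl⟩
    exact add_le_add (hB ⟨_, rfl⟩)
      (hl.sum_le_tsum _ fun j _ => (inv_pos.2 (hlpos j)).le)
  have hconv := (tendsto_atTop_ciSup hs hsB).sub hl.hasSum.tendsto_sum_nat
  have heq : (fun n => s n - ∑ j ∈ Finset.range n, (l (j + 1))⁻¹) = fun n => φ (x n) := by
    funext n; simp [s]
  rw [heq] at hconv
  obtain ⟨z, hz⟩ := (isCompact_range hφ).isClosed.mem_of_tendsto hconv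
    (Eventually.of_forall fun n => ⟨x n, rfl⟩)
  exact ⟨z, hz ▸ hconv⟩

/-- A set with a finite `(d-1)`-dimensional Minkowski content is a null set. -/
lemma HasMinkowskiContent.volume_eq_zero {d : ℕ} {A : Set (Cube d)} {M : ℝ}
    (hA : HasMinkowskiContent A M) : volume A = 0 := by
  have h1 : Tendsto (fun ε : ℝ => ε) (𝓝[>] 0) (𝓝 0) :=
    tendsto_nhdsWithin_of_tendsto_nhds tendsto_id
  have h2 := h1.mul hA
  rw [zero_mul] at h2
  have h3 : volume.real A ≤ 0 := by
    refine ge_of_tendsto h2 ?_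
    filter_upwards [self_mem_nhdsWithin] with ε hε
    have hε' : (0 : ℝ) < ε := hε
    rw [mul_inv_cancel_left₀ hε'.ne']
    exact measureReal_mono fun y hy => ⟨y, hy, by simpa using hε'.le⟩
  exact (measureReal_eq_zero_iff).1 (le_antisymm h3 measureReal_nonneg)

/-- On a compact space, an open set that contains a level set of a continuous function contains
the preimage of a neighbourhood of the level. -/
lemma exists_slab_subset {X : Type*} [TopologicalSpace X] [CompactSpace X] {φ : X → ℝ}
    (hφ : Continuous φ) {v : ℝ} {U : Set X} (hU : IsOpen U)
    (hv : ∀ y, φ y = v → y ∈ U) : ∃ δ > 0, ∀ y, |φ y - v| < δ → y ∈ U := by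
  have hcl : IsClosed (φ '' Uᶜ) := (hU.isClosed_compl.isCompact.image hφ).isClosed
  have hmem : v ∈ (φ '' Uᶜ)ᶜ := by
    rintro ⟨y, hy, rfl⟩
    exact hy (hv y rfl)
  obtain ⟨δ, hδ, hball⟩ := Metric.isOpen_iff.1 hcl.isOpen_compl v hmem
  refine ⟨δ, hδ, fun y hy => ?_⟩
  by_contra hyU
  exact hball (by rwa [Metric.mem_ball, Real.dist_eq]) ⟨y, hyU, rfl⟩

/-- Around a level below the maximum with a null level set there are levels `q₁ < q₂`, between
which `φ` lies only on a small set, as compared with the set where `φ ≥ q₂`. -/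
lemma exists_small_slab {d : ℕ} {φ : Cube d → ℝ} (hφ : Continuous φ) {v : ℝ}
    (hv : v < ⨆ y, φ y) (h0 : volume {y | φ y = v} = 0) {D c : ENNReal} (hD : D ≠ ⊤) (hc : c ≠ 0) :
    ∃ q₁ q₂ : ℚ, v ∈ Set.Ioo (q₁ : ℝ) q₂ ∧ volume {y | (q₂ : ℝ) ≤ φ y} ≠ 0 ∧
      D * volume {y | φ y ∈ Set.Ioo (q₁ : ℝ) q₂} ≤ c * volume {y | (q₂ : ℝ) ≤ φ y} := by
  obtain ⟨y₁, hy₁⟩ := exists_lt_of_lt_ciSup hv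
  obtain ⟨w, hvw, hw⟩ := exists_between hy₁
  have : (volume : Measure (Cube d)).IsOpenPosMeasure :=
    inferInstanceAs (Measure.pi fun _ : Fin d => (volume : Measure unitInterval)).IsOpenPosMeasure
  have hpos : volume {y | w < φ y} ≠ 0 :=
    ((isOpen_lt continuous_const hφ).measure_pos volume ⟨y₁, hw⟩).ne'
  set α := c * volume {y | w < φ y} / (D + 1) with hα
  have hα0 : α ≠ 0 :=
    ENNReal.div_ne_zero.2 ⟨mul_ne_zero hc hpos, ENNReal.add_ne_top.2 ⟨hD, ENNReal.one_ne_top⟩⟩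
  obtain ⟨U, hUsub, hUo, hUα⟩ := Set.exists_isOpen_lt_of_lt {y | φ y = v} α
    (by rw [h0]; exact pos_iff_ne_zero.2 hα0)
  obtain ⟨δ, hδ, hslab⟩ := exists_slab_subset hφ hUo fun y hy => hUsub hy
  obtain ⟨q₁, hq₁, hq₁v⟩ := exists_rat_btwn (sub_lt_self v hδ)
  obtain ⟨q₂, hvq₂, hq₂⟩ := exists_rat_btwn (lt_min (lt_add_of_pos_right v hδ) hvw)
  have hsub : {y | w < φ y} ⊆ {y | (q₂ : ℝ) ≤ φ y} := fun y hy =>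
    (hq₂.le.trans (min_le_right _ _)).trans (le_of_lt hy)
  have hq₂' := hq₂.trans_le (min_le_left _ _)
  refine ⟨q₁, q₂, ⟨hq₁v, hvq₂⟩, fun h => hpos (measure_mono_null hsub h), ?_⟩
  have hA : volume {y | φ y ∈ Set.Ioo (q₁ : ℝ) q₂} ≤ α := by
    refine (measure_mono fun y hy => hslab y ?_).trans hUα.le
    rw [abs_lt]
    constructor <;> linarith [hy.1, hy.2]
  calc D * volume {y | φ y ∈ Set.Ioo (q₁ : ℝ) q₂} ≤ (D + 1) * α := by
        gcongr
        exact le_self_add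
    _ ≤ c * volume {y | w < φ y} := ENNReal.mul_div_le
    _ ≤ c * volume {y | (q₂ : ℝ) ≤ φ y} := by gcongr

/-- Almost sure convergence for partially random points. -/
theorem ae_tendsto_of_isTSRSequence {d : ℕ} {K : Kernel (Cube d) (Cube d)} [IsMarkovKernel K]
    {k : Cube d → Cube d → ℝ} (hA1 : AssumptionA1 k) (hA2 : AssumptionA2 K k)
    {φ : Cube d → ℝ} (hφ : Continuous φ)
    (hlev : ∀ z, φ z < (⨆ y, φ y) → volume {y | φ y = φ z} = 0)
    {Ω : Type*} [mΩ : MeasurableSpace Ω] {P : Measure Ω} [IsProbabilityMeasure P]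
    {𝓕 : Filtration ℕ mΩ} {b t R : ℕ} {u : ℕ → Ω → Fin d → ℝ} {l : ℕ → Ω → ℝ}
    {x : ℕ → Ω → Cube d} (hu : IsTSRSequence P b t R u)
    (hind : ∀ n, Indep (MeasurableSpace.comap (u (n + 1)) inferInstance) (𝓕 n) P)
    (hx : ∀ n, Measurable[𝓕 n] (x n))
    (hrun : ∀ ω, IsRun k φ (fun n => u n ω) (fun n => l n ω) (fun n => x n ω))
    (hl : ∀ᵐ ω ∂P, Summable (fun n => (l (n + 1) ω)⁻¹)) :
    ∀ᵐ ω ∂P, Tendsto (fun n => φ (x n ω)) atTop (𝓝 (⨆ y, φ y)) := by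
  obtain ⟨hK, hk, c, hc, hck⟩ := hA2
  have pos : ∀ x y, 0 < k x y := fun x y => hc.trans_le (hck x y)
  obtain ⟨J, hJ, hJinv, hJF⟩ := exists_continuous_inverse hk pos hA1
  obtain ⟨B, hB, hKB⟩ := exists_kernel_bound hK hk
  obtain ⟨L, C, hL, hC, hu01, hum, hupper, hlower⟩ := hu.exists_bounds
  have hc0 : ENNReal.ofReal c ≠ 0 := (ENNReal.ofReal_pos.2 hc).ne'
  have hJS : ∀ y {A : Set (Cube d)}, MeasurableSet A → MeasurableSet {v | J (y, v) ∈ A} :=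
    fun y A hA => (hJ.comp (Continuous.prodMk_right y)).measurable hA
  have key : ∀ q₁ q₂ : ℚ, ∀ N : ℕ, volume {y | (q₂ : ℝ) ≤ φ y} ≠ 0 →
      2 * (L * L * (C * B)) * volume {y | φ y ∈ Set.Ioo (q₁ : ℝ) q₂} ≤
        ENNReal.ofReal c * volume {y | (q₂ : ℝ) ≤ φ y} →
      ∀ᵐ ω ∂P, ¬ ∀ n, N ≤ n → φ (x n ω) ∈ Set.Ioo (q₁ : ℝ) q₂ := by
    intro q₁ q₂ N hH0 hsmall
    have hAm : MeasurableSet {y | φ y ∈ Set.Ioo (q₁ : ℝ) q₂} := hφ.measurable measurableSet_Ioo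
    have hHm : MeasurableSet {y | (q₂ : ℝ) ≤ φ y} :=
      (isClosed_le continuous_const hφ).measurableSet
    have := measure_stay_eq_zero (A := {y | φ y ∈ Set.Ioo (q₁ : ℝ) q₂})
      (H := {y | (q₂ : ℝ) ≤ φ y}) hum hind hx hJ.measurable hAm hHm hL
      (β := C * (B * volume {y | φ y ∈ Set.Ioo (q₁ : ℝ) q₂}))
      (p := ENNReal.ofReal c * volume {y | (q₂ : ℝ) ≤ φ y}) (by finiteness) (by finiteness)
      (mul_ne_zero hc0 hH0) (le_trans (le_of_eq (by ring)) hsmall) ?_ ?_ ?_ N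
    · rw [ae_iff]
      simpa using this
    · intro n y
      refine (hupper n _ (hJS y hAm)).trans ?_
      rw [unifMeasure_preimage_inverse hK hk pos hJ hJF y hAm]
      gcongr
      exact hKB y _ hAm
    · intro q y
      refine le_trans ?_ (hlower q _ (hJS y hHm))
      rw [unifMeasure_preimage_inverse hK hk pos hJ hJF y hHm]
      exact kernel_lower_bound hK hck y hHm
    · intro n ω hn hn1
      have hr := hrun ω
      simp only [Set.mem_ofPred_eq] at hn hn1 ⊢
      rw [hJinv _ _ (hu01 (n + 1) ω)]
      set y := invRosenblatt (k (x n ω)) (u (n + 1) ω) with hy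
      by_cases h1 : φ y ∈ Set.Ioo (q₁ : ℝ) q₂
      · exact Or.inl h1
      · have h2 : x (n + 1) ω ≠ y := fun h => h1 (h ▸ hn1)
        refine Or.inr ⟨(hr.step n).resolve_right h2, fun h3 => h2 ?_⟩
        exact hr.up n (hn.2.le.trans h3)
  have key' : ∀ᵐ ω ∂P, ∀ q₁ q₂ : ℚ, ∀ N : ℕ, volume {y | (q₂ : ℝ) ≤ φ y} ≠ 0 →
      2 * (L * L * (C * B)) * volume {y | φ y ∈ Set.Ioo (q₁ : ℝ) q₂} ≤
        ENNReal.ofReal c * volume {y | (q₂ : ℝ) ≤ φ y} →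
      ¬ ∀ n, N ≤ n → φ (x n ω) ∈ Set.Ioo (q₁ : ℝ) q₂ := by
    simp only [ae_all_iff, eventually_imp_distrib_left]
    exact key
  filter_upwards [key', hl] with ω hω hlω
  obtain ⟨z, hz⟩ := (hrun ω).exists_tendsto hφ hlω
  rcases (le_ciSup (bddAbove_range_of_continuous_cube hφ) z).lt_or_eq with hlt | heq
  · obtain ⟨q₁, q₂, hq, hH, hsm⟩ := exists_small_slab hφ hlt (hlev z hlt)
      (D := 2 * (L * L * (C * B))) (c := ENNReal.ofReal c) (by finiteness) hc0
    obtain ⟨N, hN⟩ := eventually_atTop.1 (hz.eventually (isOpen_Ioo.mem_nhds hq))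
    exact absurd hN (hω q₁ q₂ N hH hsm)
  · rwa [← heq]

/-! ### Convergence for deterministic points in dimension one -/

lemma le_volume_closedBall_cube_one (a : Cube 1) {ε : ℝ} (h0 : 0 ≤ ε) (h1 : ε ≤ 1 / 2) :
    ε ≤ volume.real (Metric.closedBall a ε) := by
  have hsub : ∀ r s : unitInterval, (s : ℝ) - r = ε → a 0 ∈ Set.Icc r s →
      ε ≤ volume.real (Metric.closedBall a ε) := by
    intro r s hrs ha
    have hpre : (Function.eval (0 : Fin 1)) ⁻¹' Set.Icc r s ⊆ Metric.closedBall a ε := by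
      intro w hw
      rw [Metric.mem_closedBall, dist_pi_le_iff h0]
      intro i
      rw [Fin.fin_one_eq_zero i, Subtype.dist_eq, Real.dist_eq, abs_le]
      have h2 : (r : ℝ) ≤ w 0 := hw.1
      have h3 : (w 0 : ℝ) ≤ s := hw.2
      have h4 : (r : ℝ) ≤ a 0 := ha.1
      have h5 : (a 0 : ℝ) ≤ s := ha.2
      constructor <;> linarith
    have hmp := measurePreserving_eval (fun _ : Fin 1 => (volume : Measure unitInterval)) 0
    have hvol : volume.real ((Function.eval (0 : Fin 1)) ⁻¹' Set.Icc r s : Set (Cube 1)) = ε := by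
      rw [measureReal_def]
      refine (congrArg ENNReal.toReal
        (hmp.measure_preimage measurableSet_Icc.nullMeasurableSet)).trans ?_
      rw [unitInterval.volume_Icc, hrs, ENNReal.toReal_ofReal h0]
    exact hvol.symm.le.trans (measureReal_mono hpre)
  have ha0 := (a 0).2.1
  have ha1 := (a 0).2.2
  rcases le_total (a 0 : ℝ) (1 / 2) with h | h
  · exact hsub (a 0) ⟨a 0 + ε, by linarith, by linarith⟩ (by simp)
      ⟨le_rfl, by rw [← Subtype.coe_le_coe]; simpa using h0⟩
  · exact hsub ⟨a 0 - ε, by linarith, by linarith⟩ (a 0) (by simp)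
      ⟨by rw [← Subtype.coe_le_coe]; simpa using h0, le_rfl⟩

/-- In dimension one, a set with a finite Minkowski content is finite: the `ε`-neighbourhoods of `N`
of its points are disjoint for small `ε` and have total measure at least `N ε`. -/
lemma HasMinkowskiContent.finite {A : Set (Cube 1)} {M : ℝ} (hA : HasMinkowskiContent A M) :
    A.Finite := by
  by_contra hinf
  obtain ⟨N, hN⟩ := exists_nat_gt M
  obtain ⟨s, hsA, hs⟩ := Set.Infinite.exists_subset_card_eq hinf N
  have hsep : ∀ᶠ ε : ℝ in 𝓝[>] 0, ∀ a ∈ s, ∀ a' ∈ s, a ≠ a' → ε + ε < dist a a' := by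
    simp only [Finset.eventually_all, eventually_imp_distrib_left]
    intro a _ a' _ hne
    have ht : Tendsto (fun ε : ℝ => ε + ε) (𝓝[>] 0) (𝓝 0) := by
      have : Continuous fun ε : ℝ => ε + ε := by fun_prop
      simpa using this.continuousWithinAt.tendsto (x := 0) (s := Set.Ioi 0)
    exact ht.eventually (gt_mem_nhds (dist_pos.2 hne))
  have hhalf : ∀ᶠ ε : ℝ in 𝓝[>] 0, ε ≤ 1 / 2 :=
    nhdsWithin_le_nhds (Iic_mem_nhds (by norm_num))
  refine absurd (ge_of_tendsto hA ?_) (not_le.2 hN)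
  filter_upwards [hsep, hhalf, self_mem_nhdsWithin] with ε h1 h2 h3
  have h3' : (0 : ℝ) < ε := h3
  rw [inv_mul_eq_div, le_div_iff₀ h3']
  have hsub : (⋃ a ∈ s, Metric.closedBall a ε) ⊆ thickened A ε := by
    intro y hy
    obtain ⟨a, ha, hya⟩ := Set.mem_iUnion₂.1 hy
    exact ⟨a, hsA ha, hya⟩
  calc (N : ℝ) * ε = ∑ _a ∈ s, ε := by rw [Finset.sum_const, hs, nsmul_eq_mul]
    _ ≤ ∑ a ∈ s, volume.real (Metric.closedBall a ε) :=
        Finset.sum_le_sum fun a _ => le_volume_closedBall_cube_one a h3'.le h2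
    _ = volume.real (⋃ a ∈ s, Metric.closedBall a ε) := by
        refine (measureReal_biUnion_finset (fun a ha a' ha' hne => ?_)
          fun a _ => Metric.isClosed_closedBall.measurableSet).symm
        exact Metric.closedBall_disjoint_closedBall (h1 a ha a' ha' hne)
    _ ≤ volume.real (thickened A ε) := measureReal_mono hsub

lemma IsTSSequence.mem_Ico {s b t : ℕ} {u : ℕ → Fin s → ℝ} (hu : IsTSSequence b t u) (n : ℕ)
    (i : Fin s) : u n i ∈ Set.Ico (0 : ℝ) 1 := by
  obtain ⟨hb, -, -, h, -⟩ := hu 0 (t + n) (Nat.le_add_right _ _)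
  have hn : n < b ^ (t + n) :=
    (Nat.lt_pow_self (by omega)).trans_le (Nat.pow_le_pow_right (by omega) (by omega))
  simpa using h n hn i

/-- Short intervals contain few points of an aligned block of a one-dimensional
`(t,1)`-sequence, since they meet at most two elementary intervals. -/
lemma IsTSSequence.card_filter_abs_sub_lt {b t : ℕ} {u : ℕ → Fin 1 → ℝ} (hu : IsTSSequence b t u)
    (q e : ℕ) {v ω : ℝ} (hω : 2 * ω * (b : ℝ) ^ e ≤ 1) :
    ((Finset.range (b ^ (t + e))).filter
      fun n => |u (q * b ^ (t + e) + n) 0 - v| < ω).card ≤ 2 * b ^ t := by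
  classical
  obtain ⟨hb, -, -, h01, hnet⟩ := hu q (t + e) (Nat.le_add_right _ _)
  have hbe : (0 : ℝ) < (b : ℝ) ^ e := by positivity
  have hbox : ∀ a : ℕ, ((Finset.range (b ^ (t + e))).filter fun n =>
      u (q * b ^ (t + e) + n) ∈ bBox b (fun _ => a) (fun _ : Fin 1 => e)).card ≤ b ^ t := by
    intro a
    by_cases ha : a < b ^ e
    · exact (hnet (fun _ => a) (fun _ => e) (fun _ => ha) (by simp [add_comm])).le
    · rw [Finset.card_eq_zero.2]
      · exact Nat.zero_le _
      · refine Finset.filter_eq_empty_iff.2 fun n hn hmem => ha ?_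
        have h1 := (hmem 0).1
        have h2 := (h01 n (Finset.mem_range.1 hn) 0).2
        have h3 := h1.trans_lt h2
        rw [div_lt_one hbe] at h3
        exact_mod_cast h3
  set a₀ := ⌊(v - ω) * (b : ℝ) ^ e⌋₊
  have hsub : (Finset.range (b ^ (t + e))).filter
      (fun n => |u (q * b ^ (t + e) + n) 0 - v| < ω) ⊆
      (Finset.range (b ^ (t + e))).filter (fun n =>
        u (q * b ^ (t + e) + n) ∈ bBox b (fun _ => a₀) (fun _ : Fin 1 => e)) ∪
      (Finset.range (b ^ (t + e))).filter (fun n =>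
        u (q * b ^ (t + e) + n) ∈ bBox b (fun _ => a₀ + 1) (fun _ : Fin 1 => e)) := by
    intro n hn
    rw [Finset.mem_filter] at hn
    obtain ⟨hn, habs⟩ := hn
    rw [abs_lt] at habs
    set w := u (q * b ^ (t + e) + n) with hw
    have hw0 : 0 ≤ w 0 := (h01 n (Finset.mem_range.1 hn) 0).1
    have hmem : w ∈ bBox b (fun _ => ⌊w 0 * (b : ℝ) ^ e⌋₊) (fun _ : Fin 1 => e) := by
      intro i
      rw [Fin.fin_one_eq_zero i, Set.mem_Ico, div_le_iff₀ hbe, lt_div_iff₀ hbe]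
      exact ⟨Nat.floor_le (by positivity), Nat.lt_floor_add_one _⟩
    have hlow : a₀ ≤ ⌊w 0 * (b : ℝ) ^ e⌋₊ :=
      Nat.floor_mono (mul_le_mul_of_nonneg_right (by linarith) hbe.le)
    have hup : ⌊w 0 * (b : ℝ) ^ e⌋₊ < a₀ + 2 := by
      rw [Nat.floor_lt (by positivity)]
      have := Nat.lt_floor_add_one ((v - ω) * (b : ℝ) ^ e)
      have h5 : w 0 * (b : ℝ) ^ e ≤ (v + ω) * (b : ℝ) ^ e :=
        mul_le_mul_of_nonneg_right (by linarith) hbe.le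
      push_cast
      change (v - ω) * (b : ℝ) ^ e < a₀ + 1 at this
      linarith
    rw [Finset.mem_union, Finset.mem_filter, Finset.mem_filter]
    obtain h | h : ⌊w 0 * (b : ℝ) ^ e⌋₊ = a₀ ∨ ⌊w 0 * (b : ℝ) ^ e⌋₊ = a₀ + 1 := by omega
    · exact Or.inl ⟨hn, h ▸ hmem⟩
    · exact Or.inr ⟨hn, h ▸ hmem⟩
  refine (Finset.card_le_card hsub).trans ((Finset.card_union_le _ _).trans ?_)
  have := hbox a₀
  have := hbox (a₀ + 1)
  omega

/-- Intervals of length `η` in `[0,1]` contain points of every aligned block of `b ^ (t + e)`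
points, provided that `2 b^{-e} ≤ η`. -/
lemma IsTSSequence.exists_mem_Ioo {b t : ℕ} {u : ℕ → Fin 1 → ℝ} (hu : IsTSSequence b t u)
    (q e : ℕ) {α β : ℝ} (hα : 0 ≤ α) (hβ : β ≤ 1) (he : 2 ≤ (β - α) * (b : ℝ) ^ e) :
    ∃ n < b ^ (t + e), u (q * b ^ (t + e) + n) 0 ∈ Set.Ioo α β := by
  classical
  obtain ⟨hb, -, -, -, hnet⟩ := hu q (t + e) (Nat.le_add_right _ _)
  have hbe : (0 : ℝ) < (b : ℝ) ^ e := by positivity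
  have h1 := Nat.lt_floor_add_one (α * (b : ℝ) ^ e)
  have h2 := Nat.floor_le (by positivity : 0 ≤ α * (b : ℝ) ^ e)
  set a := ⌊α * (b : ℝ) ^ e⌋₊ + 1 with ha
  have ha' : (a : ℝ) = ⌊α * (b : ℝ) ^ e⌋₊ + 1 := by rw [ha]; push_cast; rfl
  rw [← ha'] at h1
  have h3 : (a : ℝ) + 1 ≤ β * (b : ℝ) ^ e := by linarith
  have h4 : β * (b : ℝ) ^ e ≤ (b : ℝ) ^ e := mul_le_of_le_one_left hbe.le hβ
  have hab : a < b ^ e := by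
    have : (a : ℝ) < (b : ℝ) ^ e := by linarith
    exact_mod_cast this
  have hcard := hnet (fun _ => a) (fun _ => e) (fun _ => hab) (by simp [add_comm])
  obtain ⟨n, hn⟩ := Finset.card_pos.1 (hcard.symm ▸ Nat.pow_pos (n := t) (by omega : 0 < b))
  rw [Finset.mem_filter, Finset.mem_range] at hn
  obtain ⟨h5, h6⟩ := hn.2 0
  rw [div_le_iff₀ hbe] at h5
  rw [lt_div_iff₀ hbe] at h6
  exact ⟨n, hn.1, lt_of_mul_lt_mul_right (h1.trans_le h5) hbe.le,
    lt_of_mul_lt_mul_right (h6.trans_le h3) hbe.le⟩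

/-- Convergence for deterministic points in dimension one. -/
theorem tendsto_of_isTSSequence {K : Kernel (Cube 1) (Cube 1)}
    {k : Cube 1 → Cube 1 → ℝ} (hA1 : AssumptionA1 k) (hA2 : AssumptionA2 K k)
    {φ : Cube 1 → ℝ} (hφ : Continuous φ)
    (hlev : ∀ z, φ z < (⨆ y, φ y) → {y | φ y = φ z}.Finite)
    {b t : ℕ} {u : ℕ → Fin 1 → ℝ} {l : ℕ → ℝ} {x : ℕ → Cube 1} (hu : IsTSSequence b t u)
    (hrun : IsRun k φ u l x) (hl : Summable fun n => (l (n + 1))⁻¹) :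
    Tendsto (fun n => φ (x n)) atTop (𝓝 (⨆ y, φ y)) := by
  classical
  obtain ⟨-, hk, c, hc, hck⟩ := hA2
  have pos : ∀ x y, 0 < k x y := fun x y => hc.trans_le (hck x y)
  have hkx : ∀ x, Continuous (k x) := fun x => hk.comp (Continuous.prodMk_right x)
  have hb : 2 ≤ b := (hu 0 t le_rfl).1
  obtain ⟨z, hz⟩ := hrun.exists_tendsto hφ hl
  rcases (le_ciSup (bddAbove_range_of_continuous_cube hφ) z).lt_or_eq with hlt | heq
  swap
  · rwa [← heq]
  exfalso
  let F : Cube 1 × Cube 1 → ℝ := fun p => rosenblatt (k p.1) p.2 0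
  have hF : Continuous F := continuous_rosenblatt hk pos 0
  have hFinv : ∀ n, F (x n, invRosenblatt (k (x n)) (u (n + 1))) = u (n + 1) 0 := fun n =>
    congrFun (rosenblatt_invRosenblatt (hkx _) (pos _) (hA1 _)
      fun i => Set.Ico_subset_Icc_self (hu.mem_Ico (n + 1) i)) 0
  have hupd : ∀ (y : Cube 1) (s : unitInterval), Function.update y 0 s = fun _ => s := by
    intro y s
    funext i
    rw [Fin.fin_one_eq_zero i, Function.update_self]
  have hFmono : ∀ y, StrictMono fun s : unitInterval => F (y, fun _ => s) := by
    intro y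
    have := hA1 y 0 0
    simpa only [hupd] using this
  -- An interval `(s₁, s₂)` of better points, and a lower bound on its probability.
  obtain ⟨y₁, hy₁⟩ := exists_lt_of_lt_ciSup hlt
  obtain ⟨w, hzw, hw⟩ := exists_between hy₁
  obtain ⟨s₁, s₂, hs, hIoo⟩ : ∃ s₁ s₂ : unitInterval, s₁ < s₂ ∧
      ∀ s ∈ Set.Ioo s₁ s₂, w < φ fun _ => s := by
    have hopen : IsOpen {s : unitInterval | w < φ fun _ => s} :=
      isOpen_lt continuous_const (hφ.comp (continuous_pi fun _ => continuous_id))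
    refine hopen.exists_Ioo_subset ⟨y₁ 0, ?_⟩
    have : (fun _ => y₁ 0) = y₁ := by
      funext i
      rw [Fin.fin_one_eq_zero i]
    simpa [this] using hw
  obtain ⟨η, hη, hηF⟩ : ∃ η > 0, ∀ y, η ≤ F (y, fun _ => s₂) - F (y, fun _ => s₁) := by
    have hcont : Continuous fun y : Cube 1 => F (y, fun _ => s₂) - F (y, fun _ => s₁) :=
      (hF.comp (Continuous.prodMk_left _)).sub (hF.comp (Continuous.prodMk_left _))
    obtain ⟨y, -, hy⟩ := isCompact_univ.exists_isMinOn Set.univ_nonempty hcont.continuousOn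
    exact ⟨_, sub_pos.2 (hFmono y hs), fun y' => hy (Set.mem_univ y')⟩
  have hb1 : (1 : ℝ) < b := by exact_mod_cast hb
  obtain ⟨e', he'⟩ : ∃ e' : ℕ, 2 ≤ η * (b : ℝ) ^ e' := by
    obtain ⟨e', he'⟩ := pow_unbounded_of_one_lt (2 / η) hb1
    rw [div_lt_iff₀ hη] at he'
    exact ⟨e', by linarith⟩
  -- Moves between points near the level set need inputs near one of finitely many points.
  have hA := hlev z hlt
  let V : Finset ℝ := (hA.toFinset ×ˢ hA.toFinset).image F
  obtain ⟨r, hr⟩ : ∃ r : ℕ, V.card * (2 * b ^ t) < b ^ r :=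
    ⟨_, Nat.lt_pow_self (by omega)⟩
  have hbe : (0 : ℝ) < (b : ℝ) ^ (e' + r) := by positivity
  set ω : ℝ := 1 / (2 * (b : ℝ) ^ (e' + r)) with hωdef
  have hω : 0 < ω := by positivity
  have hω1 : 2 * ω * (b : ℝ) ^ (e' + r) ≤ 1 := by
    rw [hωdef]
    field_simp
    exact le_rfl
  obtain ⟨δ, hδ, hslab⟩ : ∃ δ > 0, ∀ p : Cube 1 × Cube 1,
      |max |φ p.1 - φ z| |φ p.2 - φ z| - 0| < δ → p ∈ {p | ∃ v ∈ V, |F p - v| < ω} := by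
    refine exists_slab_subset (φ := fun p : Cube 1 × Cube 1 =>
      max |φ p.1 - φ z| |φ p.2 - φ z|) (by fun_prop) ?_ ?_
    · have : {p | ∃ v ∈ V, |F p - v| < ω} = ⋃ v ∈ V, {p | |F p - v| < ω} := by
        ext p; simp
      rw [this]
      exact isOpen_biUnion fun v _ => isOpen_lt (by fun_prop) continuous_const
    · intro p hp
      have h1 : φ p.1 = φ z := by
        have := (le_max_left _ _).trans hp.le
        exact sub_eq_zero.1 (abs_nonpos_iff.1 this)
      have h2 : φ p.2 = φ z := by
        have := (le_max_right _ _).trans hp.le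
        exact sub_eq_zero.1 (abs_nonpos_iff.1 this)
      refine ⟨F p, Finset.mem_image.2 ⟨p, Finset.mem_product.2 ?_, rfl⟩, by simpa using hω⟩
      exact ⟨hA.mem_toFinset.2 h1, hA.mem_toFinset.2 h2⟩
  obtain ⟨N, hN⟩ := eventually_atTop.1 ((hz.eventually (Metric.ball_mem_nhds _ hδ)).and
    (hz.eventually (gt_mem_nhds hzw)))
  have hnear : ∀ n, N ≤ n → |φ (x n) - φ z| < δ := fun n hn => by
    simpa [Real.dist_eq] using (hN n hn).1
  have hmove : ∀ n, N ≤ n → x (n + 1) ≠ x n → ∃ v ∈ V, |u (n + 1) 0 - v| < ω := by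
    intro n hn hne
    have h1 := (hrun.step n).resolve_left hne
    have h2 := hslab (x n, x (n + 1)) (by
      rw [sub_zero, abs_of_nonneg (le_max_of_le_left (abs_nonneg _))]
      exact max_lt (hnear n hn) (hnear (n + 1) (by omega)))
    have h3 : F (x n, x (n + 1)) = u (n + 1) 0 := by rw [h1]; exact hFinv n
    simpa only [Set.mem_ofPred_eq, h3] using h2
  have hbpos : ∀ m, 0 < b ^ m := fun m => Nat.pow_pos (by omega)
  -- Every aligned block of `b ^ (t + e')` iterations contains a move.
  have hblock : ∀ q, N < q * b ^ (t + e') → ∃ n < b ^ (t + e'),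
      ∃ i, i + 1 = q * b ^ (t + e') + n ∧ x (i + 1) ≠ x i := by
    intro q hq
    by_contra! hno
    obtain ⟨i₀, hi₀⟩ : ∃ i₀, i₀ + 1 = q * b ^ (t + e') := ⟨q * b ^ (t + e') - 1, by omega⟩
    have hconst : ∀ n ≤ b ^ (t + e'), x (i₀ + n) = x i₀ := by
      intro n
      induction n with
      | zero => intro _; rfl
      | succ n ih =>
        intro hn
        exact (hno n (by omega) (i₀ + n) (by omega)).trans (ih (by omega))
    obtain ⟨n, hn, hu1, hu2⟩ := hu.exists_mem_Ioo q e'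
      (rosenblatt_mem_Icc (hkx (x i₀)) (pos _) (fun _ => s₁) 0).1
      (rosenblatt_mem_Icc (hkx (x i₀)) (pos _) (fun _ => s₂) 0).2
      (he'.trans (mul_le_mul_of_nonneg_right (hηF (x i₀)) (by positivity)))
    rw [← hi₀, add_right_comm i₀ 1 n] at hu1 hu2
    set y := invRosenblatt (k (x (i₀ + n))) (u (i₀ + n + 1)) with hy
    have hFy : F (x i₀, fun _ => y 0) = u (i₀ + n + 1) 0 := by
      rw [← hFinv (i₀ + n), hconst n hn.le, ← hconst n hn.le, ← hy]
      congr 2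
      funext i
      rw [Fin.fin_one_eq_zero i]
    have hy1 : s₁ < y 0 := (hFmono (x i₀)).lt_iff_lt.1 (hu1.trans_eq hFy.symm)
    have hy2 : y 0 < s₂ := (hFmono (x i₀)).lt_iff_lt.1 (hFy.trans_lt hu2)
    have hφy : w < φ y := by
      have h1 := hIoo (y 0) ⟨hy1, hy2⟩
      have h2 : (fun _ => y 0) = y := by
        funext i
        rw [Fin.fin_one_eq_zero i]
      rwa [h2] at h1
    have hacc := hrun.up (i₀ + n) (((hN (i₀ + n) (by omega)).2.trans hφy).le)
    have := (hN (i₀ + n + 1) (by omega)).2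
    rw [hacc] at this
    exact lt_asymm this hφy
  -- Compare the two bounds on the number of moves in a long block.
  set Λ := b ^ (t + e') with hΛ
  have hΛpos : 0 < Λ := hbpos _
  have hlen : b ^ (t + (e' + r)) = b ^ r * Λ := by rw [hΛ]; ring
  let S : Finset ℕ := (Finset.range (b ^ (t + (e' + r)))).filter fun n =>
    ∃ v ∈ V, |u ((N + 1) * b ^ (t + (e' + r)) + n) 0 - v| < ω
  have hS1 : S.card ≤ V.card * (2 * b ^ t) := by
    have hsub : S ⊆ V.biUnion fun v => (Finset.range (b ^ (t + (e' + r)))).filter fun n =>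
        |u ((N + 1) * b ^ (t + (e' + r)) + n) 0 - v| < ω := by
      intro n hn
      obtain ⟨h1, v, hv, h2⟩ := Finset.mem_filter.1 hn
      exact Finset.mem_biUnion.2 ⟨v, hv, Finset.mem_filter.2 ⟨h1, h2⟩⟩
    exact (Finset.card_le_card hsub).trans (Finset.card_biUnion_le_card_mul _ _ _
      fun v _ => hu.card_filter_abs_sub_lt (N + 1) (e' + r) hω1)
  have hS2 : b ^ r ≤ S.card := by
    have hsub : Finset.range (b ^ r) ⊆ S.image fun n => n / Λ := by
      intro j hj
      rw [Finset.mem_range] at hj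
      have hNle : N < ((N + 1) * b ^ r + j) * Λ := by
        have h1 : 1 ≤ b ^ r * Λ := Nat.mul_pos (hbpos r) hΛpos
        nlinarith
      obtain ⟨n, hn, i, hi, hne⟩ := hblock ((N + 1) * b ^ r + j) hNle
      refine Finset.mem_image.2 ⟨j * Λ + n, Finset.mem_filter.2 ⟨?_, ?_⟩, ?_⟩
      · rw [Finset.mem_range, hlen]
        calc j * Λ + n < (j + 1) * Λ := by rw [Nat.add_mul]; omega
          _ ≤ b ^ r * Λ := Nat.mul_le_mul_right _ hj
      · have hidx : (N + 1) * b ^ (t + (e' + r)) + (j * Λ + n) = i + 1 := by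
          rw [hi, hlen]; ring
        rw [hidx]
        exact hmove i (by omega) hne
      · rw [mul_comm, Nat.mul_add_div hΛpos, Nat.div_eq_of_lt hn, add_zero]
    calc b ^ r = (Finset.range (b ^ r)).card := (Finset.card_range _).symm
      _ ≤ (S.image fun n => n / Λ).card := Finset.card_le_card hsub
      _ ≤ S.card := Finset.card_image_le
  exact absurd (hS2.trans hS1) (not_le.2 hr)

end QMCSA

theorem corollary1 {d : ℕ} (K : Kernel (QMCSA.Cube d) (QMCSA.Cube d)) [IsMarkovKernel K]
    (k : QMCSA.Cube d → QMCSA.Cube d → ℝ)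
    (hA1 : QMCSA.AssumptionA1 k) (hA2 : QMCSA.AssumptionA2 K k)
    (φ : QMCSA.Cube d → ℝ) (hφ : Continuous φ) (hlev : QMCSA.LevelSetsBounded φ) :
    (∀ (Ω : Type*) [mΩ : MeasurableSpace Ω] (P : Measure Ω) [IsProbabilityMeasure P]
        (𝓕 : Filtration ℕ mΩ)
        (b t R : ℕ) (u : ℕ → Ω → Fin d → ℝ) (l : ℕ → Ω → ℝ)
        (x0 : QMCSA.Cube d) (x : ℕ → Ω → QMCSA.Cube d),
        QMCSA.IsTSRSequence P b t R u →
        -- non-anticipation: step `n` may use the past and extra randomness, not later inputs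
        (∀ n, Measurable[𝓕 n] (u n)) →
        (∀ n, Indep (MeasurableSpace.comap (u (n + 1)) inferInstance) (𝓕 n) P) →
        (∀ n, Measurable[𝓕 n] (x n)) →
        (∀ ω, x 0 ω = x0) →
        (∀ ω, QMCSA.IsRun k φ (fun n => u n ω) (fun n => l n ω) (fun n => x n ω)) →
        (∀ᵐ ω ∂P, Summable (fun n => (l (n + 1) ω)⁻¹)) →
        ∀ᵐ ω ∂P, Tendsto (fun n => φ (x n ω)) atTop (𝓝 (⨆ y, φ y))) ∧
    (d = 1 →
      ∀ (b t : ℕ) (u : ℕ → Fin d → ℝ) (l : ℕ → ℝ) (x : ℕ → QMCSA.Cube d),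
        QMCSA.IsTSSequence b t u →
        QMCSA.IsRun k φ u l x →
        Summable (fun n => (l (n + 1))⁻¹) →
        Tendsto (fun n => φ (x n)) atTop (𝓝 (⨆ y, φ y))) := by
  obtain ⟨C, hC⟩ := hlev
  refine ⟨?_, ?_⟩
  · intro Ω mΩ P _ 𝓕 b t R u l x0 x hu _ hind hx _ hrun hl
    refine QMCSA.ae_tendsto_of_isTSRSequence hA1 hA2 hφ (fun z hz => ?_) hu hind hx hrun hl
    obtain ⟨M, -, hM⟩ := hC z hz
    exact hM.volume_eq_zero
  · rintro rfl b t u l x hu hrun hl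
    refine QMCSA.tendsto_of_isTSSequence hA1 hA2 hφ (fun z hz => ?_) hu hrun hl
    obtain ⟨M, -, hM⟩ := hC z hz
    exact hM.finite
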